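/- **Setting.** Let $n\ge 1$ and let $\mathcal C_n=\mathbb Z\times(\mathbb Z/2n\mathbb Z)$. From each vertex $(x,y)$ of $\mathbb Z^2$ or of $\mathcal C_n$ there are four directed edges, to $(x\pm1,y)$ and $(x,y\pm1)$. Fix $p\in(0,1)$. Independently over vertices, a vertex $(x,y)$ carries a two-sided mirror with probability $p$. In the *Lorentz mirror model* the mirror is, independently, a north-west mirror (along the direction $\diagdown$) or a north-east mirror (along the direction $\diagup$), with probability $\tfrac12$ each. In the *Manhattan model* it is a north-west mirror if $x-y$ is even and a north-east mirror if $x-y$ is odd. Let $\mathbb P_p$ denote the resulting law (on $\mathbb Z^2$ or on $\mathcal C_n$). Light is reflected at mirrors and goes straight at vertices without a mirror. A *trajectory* $L$ is a nonempty finite sequence of directed edges $e_i=(u_i,v_i)$, $1\le i\le m$, crossed by light in this order (so $v_i=u_{i+1}$); put $V(L)=\bigcup_{i=1}^m\{u_i,v_i\}$ and $V_{inn}(L)=\bigcup_{i=2}^{m-1}\{u_i,v_i\}$. For positive integers $k_1,k_2$, let $\mathcal E_{k_1,k_2}$ be the event, for the model on $\mathbb Z^2$, that there is a trajectory $L$ with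 first edge $((x,0),(x,1))$ and last edge $((x',k_2),(x',k_2+1))$ for some $x,x'\in\{1,\dots,k_1\}$, and with $V_{inn}(L)\subset\{1,\dots,k_1\}\times\{1,\dots,k_2\}$. **Proposition.** For either of the two models, let $c_0\in(0,1)$ and $p\in(0,1)$. There exists $C_1>0$, depending only on $c_0$ and $p$, such that for every integer $n>C_1$ the following holds: if $\mathbb P_p(\mathcal E_{100n,n})\ge c_0$, then $$\mathbb P_p\big(\mathcal E^{(loc)}_n\big)\ge\tfrac12 ,$$ where $\mathcal E^{(loc)}_n$ is the event, for the model on the cylinder $\mathcal C_n$, that every trajectory $L$ with $V(L)\cap(\{0\}\times\mathbb Z/2n\mathbb Z)\neq\emptyset$ satisfies $$V(L)\subset\{-\lfloor C_1n^{10}\rfloor,\dots,\lfloor C_1n^{10}\rfloor\}\times(\mathbb Z/2n\mathbb Z).$$ -/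

import Mathlib

namespace MirrorModel

open MeasureTheory

/-- The four lattice directions in which light can travel. -/
inductive Direction
  | east
  | north
  | west
  | south
  deriving DecidableEq

/-- The state of a vertex: no mirror, a north-west mirror (drawn `\`), or a north-east mirror
(drawn `/`). -/
inductive Site
  | empty
  | nw
  | ne
  deriving DecidableEq

instance : MeasurableSpace Site := ⊤

/-- The outgoing direction of light that arrives at a vertex in state `s` travelling in a given
direction. -/
def Site.turn : Site → Direction → Direction
  | .empty, d => d
  | .nw, .east => .south
  | .nw, .south => .east
  | .nw, .west => .north
  | .nw, .north => .west
  | .ne, .east => .north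
  | .ne, .north => .east
  | .ne, .west => .south
  | .ne, .south => .west

/-- Vertices `(x, y)`. The plane lattice is `Vertex ℤ`; the cylinder of even width `2 * n` is
`Vertex (ZMod (2 * n))`. -/
abbrev Vertex (Y : Type) : Type := ℤ × Y

/-- Mirror configurations. -/
abbrev Config (Y : Type) : Type := Vertex Y → Site

/-- A directed edge, recorded by its first vertex and its direction. -/
@[ext]
structure Edge (Y : Type) where
  src : Vertex Y
  dir : Direction

/-- The second vertex of a directed edge. -/
def Edge.tgt {Y : Type} [CommRing Y] (e : Edge Y) : Vertex Y :=
  match e.dir with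
  | .east => (e.src.1 + 1, e.src.2)
  | .north => (e.src.1, e.src.2 + 1)
  | .west => (e.src.1 - 1, e.src.2)
  | .south => (e.src.1, e.src.2 - 1)

/-- A trajectory of light in the configuration `ω`: a nonempty finite list of directed edges
crossed in order, each edge being followed by the one along which the light leaves the vertex that
it has just reached. -/
structure Trajectory {Y : Type} [CommRing Y] (ω : Config Y) where
  edges : List (Edge Y)
  ne_nil : edges ≠ []
  chain : edges.IsChain fun e f => f.src = e.tgt ∧ f.dir = (ω e.tgt).turn e.dir

namespace Trajectory

variable {Y : Type} [CommRing Y] {ω : Config Y}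

/-- The first edge. -/
def initialEdge (L : Trajectory ω) : Edge Y := L.edges.head L.ne_nil

/-- The last edge. -/
def terminalEdge (L : Trajectory ω) : Edge Y := L.edges.getLast L.ne_nil

/-- All endpoints of the edges of the trajectory. -/
def vertices (L : Trajectory ω) : Set (Vertex Y) :=
  {v | ∃ e ∈ L.edges, v = e.src ∨ v = e.tgt}

/-- All endpoints of the edges other than the first and the last one. -/
def innerVertices (L : Trajectory ω) : Set (Vertex Y) :=
  {v | ∃ e ∈ L.edges.tail.dropLast, v = e.src ∨ v = e.tgt}

end Trajectory

/-- The two models. -/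
inductive Model
  | lorentz
  | manhattan
  deriving DecidableEq

open Classical in
/-- The law of the state of the vertex `v`: a mirror is present with probability `p`. In the
Lorentz model its type is uniform; in the Manhattan model it is determined by the parity of
`x - y`. (On the cylinder the modulus `2 * n` is even, so `Even` in `ZMod (2 * n)` is the parity of
any integer representative.) -/
noncomputable def siteLaw {Y : Type} [CommRing Y] (m : Model) (p : unitInterval) (v : Vertex Y) :
    Measure Site :=
  match m with
  | .lorentz =>
      ENNReal.ofReal (1 - p) • Measure.dirac Site.empty
        + ENNReal.ofReal (p / 2) • Measure.dirac Site.nw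
        + ENNReal.ofReal (p / 2) • Measure.dirac Site.ne
  | .manhattan =>
      ENNReal.ofReal (1 - p) • Measure.dirac Site.empty
        + ENNReal.ofReal p • Measure.dirac (if Even ((v.1 : Y) - v.2) then Site.nw else Site.ne)

instance {Y : Type} [CommRing Y] (m : Model) (p : unitInterval) (v : Vertex Y) :
    IsProbabilityMeasure (siteLaw m p v) := by
  have h0 : (0 : ℝ) ≤ p := p.2.1
  have h1 : (0 : ℝ) ≤ 1 - p := sub_nonneg.2 p.2.2
  have h2 : (0 : ℝ) ≤ p / 2 := by positivity
  constructor
  cases m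
  · simp only [siteLaw, Measure.add_apply, Measure.smul_apply, measure_univ, smul_eq_mul, mul_one]
    rw [← ENNReal.ofReal_add h1 h2, ← ENNReal.ofReal_add (by positivity) h2,
      add_assoc, add_halves, sub_add_cancel, ENNReal.ofReal_one]
  · simp only [siteLaw, Measure.add_apply, Measure.smul_apply, measure_univ, smul_eq_mul, mul_one]
    rw [← ENNReal.ofReal_add h1 h0]
    norm_num

/-- The law of the whole configuration: the states of different vertices are independent. -/
noncomputable def law (Y : Type) [CommRing Y] (m : Model) (p : unitInterval) :
    Measure (Config Y) :=
  Measure.infinitePi fun v : Vertex Y => siteLaw m p v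

/-- The bottom edges of the rectangle `I × {j₁, …, j₂}` in the plane. -/
def bottomEdges (I : Set ℤ) (j₁ : ℤ) : Set (Edge ℤ) :=
  {e | ∃ x ∈ I, e = ⟨(x, j₁ - 1), .north⟩}

/-- The top edges of the rectangle `I × {j₁, …, j₂}` in the plane. -/
def topEdges (I : Set ℤ) (j₂ : ℤ) : Set (Edge ℤ) :=
  {e | ∃ x ∈ I, e = ⟨(x, j₂), .north⟩}

/-- The event that some trajectory crosses the rectangle `I × {j₁, …, j₂}` from bottom to top. -/
def crossing (I : Set ℤ) (j₁ j₂ : ℤ) : Set (Config ℤ) :=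
  {ω | ∃ L : Trajectory ω, L.initialEdge ∈ bottomEdges I j₁ ∧ L.terminalEdge ∈ topEdges I j₂ ∧
    L.innerVertices ⊆ I ×ˢ Set.Icc j₁ j₂}

/-- The crossing event for the rectangle `{1, …, k₁} × {1, …, k₂}`. -/
def boxCrossing (k₁ k₂ : ℕ) : Set (Config ℤ) :=
  crossing (Set.Icc 1 (k₁ : ℤ)) 1 k₂

/-- The part `{k₁ + 1, …, k₂} × (ℤ / 2nℤ)` of the cylinder. -/
def strip (n : ℕ) (k₁ k₂ : ℤ) : Set (Vertex (ZMod (2 * n))) :=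
  {v | k₁ + 1 ≤ v.1 ∧ v.1 ≤ k₂}

/-- The event that every trajectory on the cylinder that visits the section `x = 0` stays in
`{-⌊C n ^ 10⌋, …, ⌊C n ^ 10⌋} × (ℤ / 2nℤ)`. -/
def localized (n : ℕ) (C : ℝ) : Set (Config (ZMod (2 * n))) :=
  {ω | ∀ L : Trajectory ω, (∃ v ∈ L.vertices, v.1 = 0) →
    L.vertices ⊆ strip n (-⌊C * (n : ℝ) ^ 10⌋ - 1) ⌊C * (n : ℝ) ^ 10⌋}

end MirrorModel

/-!
Light moves deterministically and reversibly, hence along paths without common edges, and the proof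
counts those that enter the half-cylinder `x ≥ 1` and get beyond the column `T` before they leave it: `crossers ω T`
is the set of heights at which they enter, a set that decreases in `T` and is everything for
`T = 0`. If it is empty for some `T` of order `n ^ 10`, on both sides of the section `x = 0`, then
every trajectory that visits this section is confined (`mem_localized`); the two sides have the same
law by the rotation `v ↦ -v` (`real_crossers_rot`). The cylinder is cut into consecutive parts of
length `100 n`, and in each of them the set of crossers is shown to shrink with a probability of
order at least `n ^ (-8)` as long as it is not empty (`real_nonempty_mul_le`). As it can shrink at
most `2 n` times, of order `n ^ 9` parts suffice (`mul_real_nonempty_le`).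

Two factors `n ^ (-4)` make up this probability. First, by the pigeonhole principle some pair of
abscissas `x'`, `x` is joined by a crossing of the `100 n × n` box with probability of order
`n ^ (-2)`. Such a crossing in the lower half of the part of the cylinder and, independently, its
mirror image in the upper half fit together to a closed orbit that winds once around the cylinder
(`real_windingEvent`, `exists_winding_orbit`). Second, given this orbit, changing the states of at
most two vertices stops some crossing light (`exists_surgery`), and there are of order `n ^ 4` ways
to choose two vertices, each change costing a constant factor (`real_update_mul_le`).

For the surgery, one needs that crossing light meets the closed orbit: the flow of the orbit through
the half-line to the left of a vertex is unchanged along any edge that avoids the orbit, is zero far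
to the left and one far to the right (`Reach.exists_mem_orbitVertices`). One also needs two crossing
paths: light that does not cross makes a U-turn, so the heights that do not cross come in pairs
(`sum_crossers_eq_zero`), and hence the number of crossers is even, and in the Manhattan model there
are as many crossers along the orientation of the lattice as against it. Given two crossing paths
from the heights `y` and `y'`, with opposite orientations in the Manhattan model, the first
vertices at which they meet the orbit are changed so that light from `y` turns into the orbit,
follows it and leaves it backwards along the path from `y'` (`exists_reconnection`).
-/

namespace MirrorModel

open MeasureTheory

/-! ### The dynamics of light: steps, reversal and reachability -/

/-- The opposite direction. -/
def Direction.opp : Direction → Direction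
  | .east => .west
  | .north => .south
  | .west => .east
  | .south => .north

@[simp] lemma Direction.opp_opp (d : Direction) : d.opp.opp = d := by cases d <;> rfl

@[simp] lemma Site.turn_opp_turn (s : Site) (d : Direction) : s.turn (s.turn d).opp = d.opp := by
  cases s <;> cases d <;> rfl

section Dynamics

variable {Y : Type} [CommRing Y] {ω ω' : Config Y} {S S' : Set (Vertex Y)} {e f g : Edge Y}

/-- The edge `e` run through backwards. -/
def Edge.rev (e : Edge Y) : Edge Y := ⟨e.tgt, e.dir.opp⟩

@[simp] lemma Edge.rev_src (e : Edge Y) : e.rev.src = e.tgt := rfl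

@[simp] lemma Edge.rev_dir (e : Edge Y) : e.rev.dir = e.dir.opp := rfl

@[simp] lemma Edge.rev_tgt (e : Edge Y) : e.rev.tgt = e.src := by
  obtain ⟨⟨x, y⟩, d⟩ := e
  cases d <;> simp [Edge.rev, Edge.tgt, Direction.opp]

@[simp] lemma Edge.rev_rev (e : Edge Y) : e.rev.rev = e := by
  ext1
  · simp
  · simp

/-- The edge along which light travels after having crossed `e`. -/
def step (ω : Config Y) (e : Edge Y) : Edge Y := ⟨e.tgt, (ω e.tgt).turn e.dir⟩

@[simp] lemma step_src (ω : Config Y) (e : Edge Y) : (step ω e).src = e.tgt := rfl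

@[simp] lemma step_rev_step (ω : Config Y) (e : Edge Y) : step ω (step ω e).rev = e.rev := by
  ext1
  · simp
  · simp [step]

lemma step_injective (ω : Config Y) : Function.Injective (step ω) := by
  intro e f h
  have := congrArg (fun g => step ω g.rev) h
  simp only [step_rev_step] at this
  simpa using congrArg Edge.rev this

lemma iterate_step_rev (ω : Config Y) (e : Edge Y) (k : ℕ) :
    (step ω)^[k] ((step ω)^[k] e).rev = e.rev := by
  induction k with
  | zero => rfl
  | succ k ih => rw [Function.iterate_succ_apply, Function.iterate_succ_apply', step_rev_step, ih]

lemma iterate_step_rev_of_le (ω : Config Y) (e : Edge Y) {i k : ℕ} (h : i ≤ k) :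
    (step ω)^[i] ((step ω)^[k] e).rev = ((step ω)^[k - i] e).rev := by
  have := iterate_step_rev ω ((step ω)^[k - i] e) i
  rwa [← Function.iterate_add_apply, Nat.add_sub_cancel' h] at this

/-- Light that has crossed `e` later crosses `f`, and at every vertex where it arrives before
crossing `f` it is in `S`. -/
def Reach (ω : Config Y) (S : Set (Vertex Y)) : Edge Y → Edge Y → Prop :=
  Relation.ReflTransGen fun e f => e.tgt ∈ S ∧ f = step ω e

lemma Reach.refl (e : Edge Y) : Reach ω S e e := Relation.ReflTransGen.refl

lemma Reach.trans (h : Reach ω S e f) (h' : Reach ω S f g) : Reach ω S e g :=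
  Relation.ReflTransGen.trans h h'

lemma Reach.single (h : e.tgt ∈ S) : Reach ω S e (step ω e) :=
  Relation.ReflTransGen.single ⟨h, rfl⟩

lemma Reach.head (h : e.tgt ∈ S) (h' : Reach ω S (step ω e) f) : Reach ω S e f :=
  (Reach.single h).trans h'

lemma Reach.tail (h : Reach ω S e f) (h' : f.tgt ∈ S) : Reach ω S e (step ω f) :=
  h.trans (Reach.single h')

lemma Reach.mono (h : Reach ω S e f) (hS : S ⊆ S') : Reach ω S' e f :=
  Relation.ReflTransGen.mono (fun _ _ h => ⟨hS h.1, h.2⟩) _ _ h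

lemma Reach.congr (h : Reach ω S e f) (hω : ∀ v ∈ S, ω v = ω' v) : Reach ω' S e f := by
  refine Relation.ReflTransGen.mono (fun a b hab => ⟨hab.1, ?_⟩) _ _ h
  rw [hab.2, step, step, hω _ hab.1]

lemma Reach.rev (h : Reach ω S e f) : Reach ω S f.rev e.rev := by
  induction h with
  | refl => exact Reach.refl _
  | tail _ hbc ih =>
    obtain ⟨hb, rfl⟩ := hbc
    refine Reach.head (by simpa using hb) ?_
    rwa [step_rev_step]

lemma reach_iff_iterate :
    Reach ω S e f ↔ ∃ k, (step ω)^[k] e = f ∧ ∀ i < k, ((step ω)^[i] e).tgt ∈ S := by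
  constructor
  · intro h
    induction h with
    | refl => exact ⟨0, rfl, by simp⟩
    | tail _ hbc ih =>
      obtain ⟨k, hk, hi⟩ := ih
      refine ⟨k + 1, by rw [Function.iterate_succ_apply', hk, hbc.2], fun i hik => ?_⟩
      rcases Nat.lt_succ_iff_lt_or_eq.1 hik with h | rfl
      · exact hi i h
      · rw [hk]; exact hbc.1
  · rintro ⟨k, rfl, hi⟩
    induction k with
    | zero => exact Reach.refl _
    | succ k ih =>
      rw [Function.iterate_succ_apply']
      exact (ih fun i h => hi i (by omega)).tail (hi k (by omega))

/-- Light starting from `e` either stays in `S'` until it reaches `f`, or leaves `S'` for a first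
time on its way. -/
lemma Reach.inter_or_exit (h : Reach ω S e f) (S' : Set (Vertex Y)) :
    Reach ω (S ∩ S') e f ∨ ∃ f', Reach ω (S ∩ S') e f' ∧ Reach ω S f' f ∧ f'.tgt ∈ S \ S' := by
  induction h with
  | refl => exact .inl (Reach.refl _)
  | @tail b c hab hbc ih =>
    obtain ⟨hb, rfl⟩ := hbc
    rcases ih with ih | ⟨f', h1, h2, h3⟩
    · by_cases hb' : b.tgt ∈ S'
      · exact .inl (ih.tail ⟨hb, hb'⟩)
      · exact .inr ⟨b, ih, Reach.single hb, hb, hb'⟩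
    · exact .inr ⟨f', h1, h2.tail hb, h3⟩

/-- Light leaves a region at most once: the first edge that leads out of `S` is unique. -/
lemma Reach.exit_unique (h : Reach ω S e f) (h' : Reach ω S e g) (hf : f.tgt ∉ S)
    (hg : g.tgt ∉ S) : f = g := by
  induction h using Relation.ReflTransGen.head_induction_on with
  | refl =>
    rcases Relation.ReflTransGen.cases_head h' with h | ⟨_, h, -⟩
    · exact h
    · exact absurd h.1 hf
  | head hab _ ih =>
    obtain ⟨ha, rfl⟩ := hab
    rcases Relation.ReflTransGen.cases_head h' with rfl | ⟨_, h, h2⟩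
    · exact absurd ha hg
    · obtain ⟨-, rfl⟩ := h
      exact ih h2

lemma Reach.src_mem (h : Reach ω S e f) : f = e ∨ f.src ∈ S := by
  rcases Relation.ReflTransGen.cases_tail h with h | ⟨_, -, h⟩
  · exact .inl h
  · exact .inr (by rw [h.2]; exact h.1)

end Dynamics

/-! ### Closed trajectories that wind around the cylinder -/

section Loops

variable {Y : Type} [CommRing Y] {ω : Config Y} {S S' : Set (Vertex Y)} {e f g : Edge Y}

/-- The vertices at which light that starts from `g` arrives. -/
def orbitVertices (ω : Config Y) (g : Edge Y) : Set (Vertex Y) :=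
  {v | ∃ i, ((step ω)^[i] g).tgt = v}

lemma tgt_mem_orbitVertices (ω : Config Y) (g : Edge Y) (i : ℕ) :
    ((step ω)^[i] g).tgt ∈ orbitVertices ω g := ⟨i, rfl⟩

lemma src_mem_orbitVertices {N : ℕ} (hN : 0 < N) (hg : (step ω)^[N] g = g) (i : ℕ) :
    ((step ω)^[i] g).src ∈ orbitVertices ω g := by
  refine ⟨i + (N - 1), ?_⟩
  rw [← step_src ω, ← Function.iterate_succ_apply' (step ω),
    show (i + (N - 1)).succ = i + N by omega, Function.iterate_add_apply, hg]

/-- The signed number of times (`1`, `-1` or `0`) that the edge `e` crosses, from bottom to top, the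
half-line at height `y + 1 / 2` that ends at the abscissa `x + 1 / 2` and extends to the left. -/
noncomputable def flow (x : ℤ) (y : Y) (e : Edge Y) : ℤ :=
  open Classical in
  match e.dir with
  | .north => if e.src.2 = y ∧ e.src.1 ≤ x then 1 else 0
  | .south => if e.src.2 = y + 1 ∧ e.src.1 ≤ x then -1 else 0
  | _ => 0

lemma tgt_east (a : ℤ) (b : Y) : Edge.tgt ⟨(a, b), .east⟩ = (a + 1, b) := rfl

lemma tgt_north (a : ℤ) (b : Y) : Edge.tgt ⟨(a, b), .north⟩ = (a, b + 1) := rfl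

lemma tgt_west (a : ℤ) (b : Y) : Edge.tgt ⟨(a, b), .west⟩ = (a - 1, b) := rfl

lemma tgt_south (a : ℤ) (b : Y) : Edge.tgt ⟨(a, b), .south⟩ = (a, b - 1) := rfl

lemma flow_east (x a : ℤ) (y b : Y) : flow x y ⟨(a, b), .east⟩ = 0 := rfl

lemma flow_west (x a : ℤ) (y b : Y) : flow x y ⟨(a, b), .west⟩ = 0 := rfl

open Classical in
lemma flow_north (x a : ℤ) (y b : Y) :
    flow x y ⟨(a, b), .north⟩ = if b = y ∧ a ≤ x then 1 else 0 := rfl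

open Classical in
lemma flow_south (x a : ℤ) (y b : Y) :
    flow x y ⟨(a, b), .south⟩ = if b = y + 1 ∧ a ≤ x then -1 else 0 := rfl

lemma flow_of_lt {x : ℤ} (y : Y) (h : x < e.src.1) : flow x y e = 0 := by
  have h' : ¬ e.src.1 ≤ x := not_le.2 h
  unfold flow
  split <;> simp [h']

open Classical in
lemma flow_congr_of_le {x x' : ℤ} (y : Y) (h : e.src.1 ≤ x) (h' : e.src.1 ≤ x') :
    flow x y e = flow x' y e := by
  obtain ⟨⟨a, b⟩, d⟩ := e
  have ha : a ≤ x := h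
  have ha' : a ≤ x' := h'
  cases d
  · rfl
  · simp only [flow_north, ha, ha']
  · rfl
  · simp only [flow_south, ha, ha']

open Classical in
lemma flow_succ_left {x : ℤ} {y : Y} (h : e.src ≠ (x + 1, y)) (h' : e.tgt ≠ (x + 1, y)) :
    flow (x + 1) y e = flow x y e := by
  obtain ⟨⟨a, b⟩, d⟩ := e
  have key : ∀ P : Prop, (P → a ≠ x + 1) → ((P ∧ a ≤ x + 1) ↔ (P ∧ a ≤ x)) := by
    intro P hP
    constructor <;> rintro ⟨h1, h2⟩ <;> refine ⟨h1, ?_⟩ <;> have := hP h1 <;> omega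
  cases d
  · rfl
  · simp only [ne_eq, Prod.mk.injEq, not_and] at h
    rw [flow_north, flow_north, if_congr (key (b = y) fun hb ha => h ha hb) rfl rfl]
  · rfl
  · simp only [tgt_south, ne_eq, Prod.mk.injEq, not_and, sub_eq_iff_eq_add] at h'
    rw [flow_south, flow_south, if_congr (key (b = y + 1) fun hb ha => h' ha hb) rfl rfl]

open Classical in
/-- Conservation of flow: for an edge that avoids the vertex `(x, y + 1)`, the flow through the
half-line just below minus the flow through the half-line just above is the increment along the edge
of the indicator function of the set of vertices between these half-lines. -/
lemma flow_sub_flow_succ {x : ℤ} {y : Y} (h : e.src ≠ (x, y + 1))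
    (h' : e.tgt ≠ (x, y + 1)) :
    flow x y e - flow x (y + 1) e
      = (if e.tgt.2 = y + 1 ∧ e.tgt.1 ≤ x then (1 : ℤ) else 0)
        - if e.src.2 = y + 1 ∧ e.src.1 ≤ x then (1 : ℤ) else 0 := by
  obtain ⟨⟨a, b⟩, d⟩ := e
  cases d
  · simp only [ne_eq, Prod.mk.injEq, not_and'] at h
    have : (b = y + 1 ∧ a + 1 ≤ x) ↔ (b = y + 1 ∧ a ≤ x) := by
      constructor <;> rintro ⟨h1, h2⟩ <;> refine ⟨h1, ?_⟩ <;> have := h h1 <;> omega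
    simp only [flow_east, tgt_east, this, sub_self]
  · simp only [flow_north, tgt_north, add_left_inj]
  · simp only [tgt_west, ne_eq, Prod.mk.injEq, not_and'] at h'
    have : (b = y + 1 ∧ a - 1 ≤ x) ↔ (b = y + 1 ∧ a ≤ x) := by
      constructor <;> rintro ⟨h1, h2⟩ <;> refine ⟨h1, ?_⟩ <;> have := h' h1 <;> omega
    simp only [flow_west, tgt_west, this, sub_self]
  · simp only [flow_south, tgt_south, sub_eq_iff_eq_add]
    split_ifs <;> rfl

/-- The total flow of the first `N` edges of the orbit of `g` through the half-line that ends just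
above and to the right of `v`. -/
noncomputable def totalFlow (ω : Config Y) (g : Edge Y) (N : ℕ) (v : Vertex Y) : ℤ :=
  ∑ i ∈ Finset.range N, flow v.1 v.2 ((step ω)^[i] g)

variable {N : ℕ}

lemma totalFlow_east (hN : 0 < N) (hg : (step ω)^[N] g = g) {x : ℤ} {y : Y}
    (h : (x + 1, y) ∉ orbitVertices ω g) :
    totalFlow ω g N (x + 1, y) = totalFlow ω g N (x, y) := by
  refine Finset.sum_congr rfl fun i _ => flow_succ_left ?_ ?_
  · intro h'
    exact h (h' ▸ src_mem_orbitVertices hN hg i)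
  · intro h'
    exact h (h' ▸ tgt_mem_orbitVertices ω g i)

lemma totalFlow_north (hN : 0 < N) (hg : (step ω)^[N] g = g) {x : ℤ} {y : Y}
    (h : (x, y + 1) ∉ orbitVertices ω g) :
    totalFlow ω g N (x, y + 1) = totalFlow ω g N (x, y) := by
  classical
  let φ : Vertex Y → ℤ := fun v => if v.2 = y + 1 ∧ v.1 ≤ x then 1 else 0
  have key : ∀ i, flow x y ((step ω)^[i] g) - flow x (y + 1) ((step ω)^[i] g)
      = φ ((step ω)^[i + 1] g).src - φ ((step ω)^[i] g).src := by
    intro i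
    rw [Function.iterate_succ_apply', step_src]
    refine flow_sub_flow_succ ?_ ?_
    · intro h'
      exact h (h' ▸ src_mem_orbitVertices hN hg i)
    · intro h'
      exact h (h' ▸ tgt_mem_orbitVertices ω g i)
  have := Finset.sum_range_sub (fun i => φ ((step ω)^[i] g).src) N
  rw [← Finset.sum_congr rfl fun i _ => key i, Finset.sum_sub_distrib, hg] at this
  simp only [Function.iterate_zero, id, sub_self] at this
  simp only [totalFlow]
  linarith

/-- The total flow of a closed orbit does not change along an edge that avoids the orbit. -/
lemma totalFlow_tgt (hN : 0 < N) (hg : (step ω)^[N] g = g) (hs : e.src ∉ orbitVertices ω g)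
    (ht : e.tgt ∉ orbitVertices ω g) : totalFlow ω g N e.tgt = totalFlow ω g N e.src := by
  obtain ⟨⟨a, b⟩, d⟩ := e
  cases d
  · exact totalFlow_east hN hg ht
  · exact totalFlow_north hN hg ht
  · have := totalFlow_east (x := a - 1) (y := b) hN hg (by simpa using hs)
    rw [tgt_west, ← this, sub_add_cancel]
  · have := totalFlow_north (x := a) (y := b - 1) hN hg (by simpa using hs)
    rw [tgt_south, ← this, sub_add_cancel]

lemma Reach.totalFlow_eq (h : Reach ω S e f) (hN : 0 < N) (hg : (step ω)^[N] g = g)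
    (hS : S ⊆ (orbitVertices ω g)ᶜ) (he : e.src ∉ orbitVertices ω g)
    (hf : f.tgt ∉ orbitVertices ω g) : totalFlow ω g N f.tgt = totalFlow ω g N e.src := by
  induction h using Relation.ReflTransGen.head_induction_on with
  | refl => exact totalFlow_tgt hN hg he hf
  | head hab _ ih =>
    obtain ⟨ha, rfl⟩ := hab
    rw [ih (hS ha)]
    exact totalFlow_tgt hN hg he (hS ha)

end Loops

section Winding

variable {n : ℕ} {ω : Config (ZMod (2 * n))} {g e f : Edge (ZMod (2 * n))} {N : ℕ} {t T : ℤ}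

/-- Light that passes from the left of a closed orbit of winding number one to its right meets this
orbit. -/
lemma Reach.exists_mem_orbitVertices [NeZero n] {S : Set (Vertex (ZMod (2 * n)))}
    (h : Reach ω S e f) (hN : 0 < N) (hg : (step ω)^[N] g = g)
    (hcol : orbitVertices ω g ⊆ strip n t T) (hflow : totalFlow ω g N (T, 0) = 1)
    (he : e.src.1 ≤ t) (hf : T < f.tgt.1) : ¬ S ⊆ (orbitVertices ω g)ᶜ := by
  intro hS
  have hsrc : ∀ i, t + 1 ≤ ((step ω)^[i] g).src.1 ∧ ((step ω)^[i] g).src.1 ≤ T := fun i =>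
    hcol (src_mem_orbitVertices hN hg i)
  have he' : e.src ∉ orbitVertices ω g := fun h => by have := (hcol h).1; omega
  have hright : ∀ y, (f.tgt.1, y) ∉ orbitVertices ω g := fun y h => by
    have : f.tgt.1 ≤ T := (hcol h).2
    omega
  have h1 := h.totalFlow_eq hN hg hS he' (hright f.tgt.2)
  have h0 : totalFlow ω g N e.src = 0 :=
    Finset.sum_eq_zero fun i _ => flow_of_lt _ (by have := (hsrc i).1; omega)
  have hrow : ∀ k : ℕ, totalFlow ω g N (f.tgt.1, (k : ZMod (2 * n)))
      = totalFlow ω g N (f.tgt.1, 0) := by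
    intro k
    induction k with
    | zero => simp
    | succ k ih =>
      rw [← ih]
      push_cast
      exact totalFlow_north hN hg (hright _)
  obtain ⟨k, hk⟩ := ZMod.natCast_zmod_surjective f.tgt.2
  have h2 : totalFlow ω g N (f.tgt.1, 0) = totalFlow ω g N (T, 0) :=
    Finset.sum_congr rfl fun i _ =>
      flow_congr_of_le _ (by have := (hsrc i).2; simp only; omega) (hsrc i).2
  have h3 : totalFlow ω g N f.tgt = 1 := by
    rw [← hflow, ← h2, ← hrow k, hk]
  omega

/-- The rows `1, …, n` of the cylinder. -/
def lowerHalf (n : ℕ) : Set (Vertex (ZMod (2 * n))) := {v | 1 ≤ v.2.val ∧ v.2.val ≤ n}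

lemma val_one_of_neZero [NeZero n] : (1 : ZMod (2 * n)).val = 1 := by
  have := NeZero.pos n
  have h : 1 < 2 * n := by omega
  have : Fact (1 < 2 * n) := ⟨h⟩
  exact ZMod.val_one _

lemma val_cast_self [NeZero n] : ((n : ℕ) : ZMod (2 * n)).val = n := by
  have := NeZero.pos n
  exact ZMod.val_natCast_of_lt (by omega)

/-- A crossing of the lower half followed by a crossing of the upper half back to the starting edge
is a closed orbit of winding number one. -/
lemma exists_winding_orbit [NeZero n] {x x' : ℤ}
    (h₁ : Reach ω (strip n t T ∩ lowerHalf n) ⟨(x', 0), .north⟩ ⟨(x, n), .north⟩)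
    (h₂ : Reach ω (strip n t T ∩ (lowerHalf n)ᶜ) ⟨(x, n), .north⟩ ⟨(x', 0), .north⟩) :
    ∃ g : Edge (ZMod (2 * n)), ∃ N, 0 < N ∧ (step ω)^[N] g = g ∧
      orbitVertices ω g ⊆ strip n t T ∧ totalFlow ω g N (T, 0) = 1 := by
  have hn := NeZero.pos n
  obtain ⟨k, hk, hlow⟩ := reach_iff_iterate.1 h₁
  obtain ⟨k', hk', hupp⟩ := reach_iff_iterate.1 h₂
  set g : Edge (ZMod (2 * n)) := ⟨(x', 0), .north⟩ with hgdef
  have hn0 : (n : ZMod (2 * n)) ≠ 0 := by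
    intro h
    have := congrArg ZMod.val h
    rw [val_cast_self, ZMod.val_zero] at this
    omega
  have hk0 : 0 < k := by
    rcases Nat.eq_zero_or_pos k with rfl | h
    · have := congrArg (fun e : Edge (ZMod (2 * n)) => e.src.2) hk
      exact absurd this.symm hn0
    · exact h
  have hupp' : ∀ i, k ≤ i → i < k + k' →
      ((step ω)^[i] g).tgt ∈ strip n t T ∩ (lowerHalf n)ᶜ := by
    intro i hi hi'
    have := hupp (i - k) (by omega)
    rwa [← hk, ← Function.iterate_add_apply, Nat.sub_add_cancel hi] at this
  have hper : (step ω)^[k + k'] g = g := by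
    rw [add_comm, Function.iterate_add_apply, hk, hk']
  have hcol : orbitVertices ω g ⊆ strip n t T := by
    rintro _ ⟨i, rfl⟩
    have hmod : (step ω)^[i] g = (step ω)^[i % (k + k')] g := by
      conv_lhs => rw [← Nat.mod_add_div i (k + k'), Function.iterate_add_apply,
        Function.iterate_mul, Function.iterate_fixed hper]
    rw [hmod]
    have hlt := Nat.mod_lt i (show 0 < k + k' by omega)
    rcases lt_or_ge (i % (k + k')) k with h | h
    · exact (hlow _ h).1
    · exact (hupp' _ h hlt).1
  refine ⟨g, k + k', by omega, hper, hcol, ?_⟩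
  have hT : x' ≤ T := (hcol (src_mem_orbitVertices (by omega) hper 0)).2
  -- The first edge is the only one between the rows `0` and `1`.
  rw [totalFlow, Finset.sum_eq_single 0]
  · simp [flow, hgdef, hT]
  · intro i hi hi0
    rw [Finset.mem_range] at hi
    obtain ⟨j, rfl⟩ := Nat.exists_eq_succ_of_ne_zero hi0
    set e := (step ω)^[j.succ] g with he
    have hes : e.src = ((step ω)^[j] g).tgt := by rw [he, Function.iterate_succ_apply', step_src]
    rcases lt_trichotomy j.succ k with h | h | h
    · have h1 := (hlow _ h).2
      have h2 := (hlow j (by omega)).2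
      rw [← hes] at h2
      rw [← he] at h1
      clear_value e
      simp only [lowerHalf, Set.mem_ofPred_eq] at h1 h2
      obtain ⟨⟨a, b⟩, d⟩ := e
      cases d
      · rfl
      · rw [flow_north, if_neg]
        rintro ⟨rfl, -⟩
        simp at h2
      · rfl
      · rw [flow_south, if_neg]
        rintro ⟨rfl, -⟩
        simp [tgt_south] at h1
    · rw [he, h, hk]
      simp [flow, hn0]
    · have h1 := (hupp' _ h.le hi).2
      have h2 := (hupp' j (by omega) (by omega)).2
      rw [← hes] at h2
      rw [← he] at h1
      clear_value e
      simp only [lowerHalf, Set.mem_ofPred_eq, Set.mem_compl_iff] at h1 h2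
      obtain ⟨⟨a, b⟩, d⟩ := e
      cases d
      · rfl
      · rw [flow_north, if_neg]
        rintro ⟨rfl, -⟩
        apply h1
        simp only [tgt_north, zero_add, val_one_of_neZero]
        omega
      · rfl
      · rw [flow_south, if_neg]
        rintro ⟨rfl, -⟩
        apply h2
        simp only [zero_add, val_one_of_neZero]
        omega
  · intro h
    simp at h
    omega

end Winding

/-! ### Light that crosses a piece of the cylinder -/

section Crossers

variable {n : ℕ} {ω ω' : Config (ZMod (2 * n))} {T T' : ℤ} {y y' : ZMod (2 * n)}
  {e f : Edge (ZMod (2 * n))}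

/-- The edge along which light enters the half-cylinder `x ≥ 1` at height `y`. -/
def entry (y : ZMod (2 * n)) : Edge (ZMod (2 * n)) := ⟨(0, y), .east⟩

lemma entry_injective : Function.Injective (entry (n := n)) := fun y y' h => by
  simpa [entry] using h

/-- The heights `y` at which light entering the half-cylinder `x ≥ 1` gets beyond the column `T`
before it leaves the half-cylinder. -/
def crossers (ω : Config (ZMod (2 * n))) (T : ℤ) : Set (ZMod (2 * n)) :=
  {y | ∃ f, Reach ω {v | 1 ≤ v.1} (entry y) f ∧ T < f.tgt.1}

lemma crossers_anti (ω : Config (ZMod (2 * n))) (h : T ≤ T') : crossers ω T' ⊆ crossers ω T := by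
  rintro y ⟨f, hf, hT⟩
  exact ⟨f, hf, h.trans_lt hT⟩

lemma mem_strip_zero {v : Vertex (ZMod (2 * n))} : v ∈ strip n 0 T ↔ 1 ≤ v.1 ∧ v.1 ≤ T := by
  simp [strip]

/-- Light that enters at height `y` and crosses does so without a visit to the region beyond `T`. -/
lemma mem_crossers_iff :
    y ∈ crossers ω T ↔ ∃ f, Reach ω (strip n 0 T) (entry y) f ∧ T < f.tgt.1 := by
  constructor
  · rintro ⟨f, hf, hT⟩
    rcases hf.inter_or_exit {v | v.1 ≤ T} with h | ⟨f', h, -, h2⟩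
    · exact ⟨f, h.mono fun v hv => mem_strip_zero.2 hv, hT⟩
    · exact ⟨f', h.mono fun v hv => mem_strip_zero.2 hv, not_le.1 h2.2⟩
  · rintro ⟨f, hf, hT⟩
    exact ⟨f, hf.mono fun v hv => (mem_strip_zero.1 hv).1, hT⟩

lemma crossers_congr (h : ∀ v ∈ strip n 0 T, ω v = ω' v) : crossers ω T = crossers ω' T := by
  ext y
  rw [mem_crossers_iff, mem_crossers_iff]
  constructor
  · rintro ⟨f, hf, hT⟩
    exact ⟨f, hf.congr h, hT⟩
  · rintro ⟨f, hf, hT⟩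
    exact ⟨f, hf.congr fun v hv => (h v hv).symm, hT⟩

lemma crossers_zero (ω : Config (ZMod (2 * n))) : crossers ω 0 = Set.univ :=
  Set.eq_univ_of_forall fun y => ⟨entry y, Reach.refl _, by simp [entry, tgt_east]⟩

lemma strip_finite [NeZero n] (t T : ℤ) : (strip n t T).Finite := by
  have : strip n t T = (Set.Icc (t + 1) T) ×ˢ (Set.univ : Set (ZMod (2 * n))) := by
    ext v
    simp [strip]
  rw [this]
  exact (Set.finite_Icc _ _).prod Set.finite_univ

lemma finite_setOf_src_mem {Y : Type} {S : Set (Vertex Y)} (hS : S.Finite) :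
    {e : Edge Y | e.src ∈ S}.Finite := by
  have hd : (Set.univ : Set Direction).Finite := by
    refine Set.Finite.subset (s := {.east, .north, .west, .south}) (by simp) ?_
    intro d _
    cases d <;> simp
  refine ((hS.prod hd).image fun q => (⟨q.1, q.2⟩ : Edge Y)).subset ?_
  intro e he
  exact ⟨(e.src, e.dir), ⟨he, trivial⟩, rfl⟩

/-- Light that enters a finite region from outside has to leave it. -/
lemma exists_exit {Y : Type} [CommRing Y] {ω : Config Y} {S : Set (Vertex Y)} (hS : S.Finite)
    {e : Edge Y} (he : e.src ∉ S) : ∃ f, Reach ω S e f ∧ f.tgt ∉ S := by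
  by_contra! hcon
  have hin : ∀ k, Reach ω S e ((step ω)^[k] e) := by
    intro k
    induction k with
    | zero => exact Reach.refl _
    | succ k ih =>
      rw [Function.iterate_succ_apply']
      exact ih.tail (hcon _ ih)
  have hsrc : ∀ k, ((step ω)^[k + 1] e).src ∈ S := fun k => by
    rw [Function.iterate_succ_apply', step_src]
    exact hcon _ (hin k)
  obtain ⟨i, -, j, -, hij, heq⟩ := Set.infinite_univ.exists_ne_map_eq_of_mapsTo
    (f := fun k : ℕ => (step ω)^[k + 1] e) (fun k _ => hsrc k) (finite_setOf_src_mem hS)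
  -- The orbit would be periodic, hence would come back to the edge from which it entered.
  have key : ∀ i j : ℕ, i < j → (step ω)^[i + 1] e = (step ω)^[j + 1] e → False := by
    intro i j hlt h
    have h2 : j + 1 = (i + 1) + ((j - i - 1) + 1) := by omega
    rw [h2, Function.iterate_add_apply _ (i + 1) (j - i - 1 + 1)] at h
    have h3 := (step_injective ω).iterate _ h
    exact he (by rw [h3]; exact hsrc _)
  rcases lt_or_gt_of_ne hij with h | h
  · exact key i j h heq
  · exact key j i h heq.symm

lemma entry_src_notMem : (entry y).src ∉ strip n 0 T := fun h => by
  have := (mem_strip_zero.1 h).1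
  simp [entry] at this

/-- Light that does not cross makes a U-turn. -/
lemma exists_uturn [NeZero n] (hy : y ∉ crossers ω T) :
    ∃ y', Reach ω (strip n 0 T) (entry y) (entry y').rev := by
  obtain ⟨f, hf, hft⟩ := exists_exit (strip_finite 0 T) (entry_src_notMem (y := y))
    (ω := ω)
  have h1 : f.tgt.1 ≤ T := by
    by_contra h
    exact hy (mem_crossers_iff.2 ⟨f, hf, not_le.1 h⟩)
  have h2 : f.tgt.1 ≤ 0 := by
    rw [mem_strip_zero] at hft
    omega
  rcases hf.src_mem with rfl | h3
  · simp [entry, tgt_east] at h2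
  · have h4 := (mem_strip_zero.1 h3).1
    obtain ⟨⟨a, b⟩, d⟩ := f
    have h5 : 1 ≤ a := h4
    cases d
    · simp only [tgt_east] at h2
      omega
    · simp only [tgt_north] at h2
      omega
    · simp only [tgt_west] at h2
      obtain rfl : a = 1 := by omega
      exact ⟨b, hf⟩
    · simp only [tgt_south] at h2
      omega

lemma notMem_crossers_of_uturn (h : Reach ω (strip n 0 T) (entry y) (entry y').rev) :
    y ∉ crossers ω T := by
  rw [mem_crossers_iff]
  rintro ⟨f, hf, hT⟩
  have h1 : f.tgt ∉ strip n 0 T := fun h => by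
    have := (mem_strip_zero.1 h).2
    omega
  have h2 : (entry y').rev.tgt ∉ strip n 0 T := by
    rw [Edge.rev_tgt]
    exact entry_src_notMem
  have h3 := hf.exit_unique h h1 h2
  rw [h3, Edge.rev_tgt] at hT
  rw [h3, Edge.rev_tgt] at h1
  rcases hf.src_mem with h4 | h4
  · have := congrArg Edge.dir (h3.symm.trans h4)
    simp [entry, Direction.opp] at this
  · rw [h3, Edge.rev_src, mem_strip_zero] at h4
    simp only [entry, tgt_east] at h4 hT
    omega

/-- Light never runs back along its own path. -/
lemma not_reach_rev {Y : Type} [CommRing Y] {ω : Config Y} {S : Set (Vertex Y)} (e : Edge Y) :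
    ¬ Reach ω S e e.rev := by
  rw [reach_iff_iterate]
  rintro ⟨k, hk, -⟩
  have key : ∀ i ≤ k, (step ω)^[i] e = ((step ω)^[k - i] e).rev := fun i hi => by
    rw [← iterate_step_rev_of_le ω e hi, hk, Edge.rev_rev]
  -- The middle of the path would have to be its own reversal.
  rcases Nat.even_or_odd' k with ⟨i, rfl | rfl⟩
  · have h := congrArg Edge.dir (key i (by omega))
    rw [show 2 * i - i = i by omega] at h
    generalize (step ω)^[i] e = f at h
    obtain ⟨v, d⟩ := f
    cases d <;> simp [Direction.opp] at h
  · have h := congrArg Edge.dir (key i (by omega))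
    rw [show 2 * i + 1 - i = i + 1 by omega, Function.iterate_succ_apply'] at h
    generalize (step ω)^[i] e = f at h
    simp only [Edge.rev_dir, step] at h
    generalize ω f.tgt = s at h
    generalize f.dir = d at h
    cases s <;> cases d <;> simp [Direction.opp, Site.turn] at h

open Classical in
/-- U-turns pair the heights that do not cross, so that a function of total sum zero that changes
sign along each U-turn also has sum zero over the heights that cross. -/
lemma sum_crossers_eq_zero [NeZero n] {R : Type*} [AddCommGroup R]
    (φ : ZMod (2 * n) → R) (hφ : ∑ y, φ y = 0)
    (hU : ∀ y y', Reach ω (strip n 0 T) (entry y) (entry y').rev → φ y + φ y' = 0) :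
    ∑ y with y ∈ crossers ω T, φ y = 0 := by
  have huniq : ∀ y a b, Reach ω (strip n 0 T) (entry y) (entry a).rev →
      Reach ω (strip n 0 T) (entry y) (entry b).rev → a = b := by
    intro y a b ha hb
    have := ha.exit_unique hb (by rw [Edge.rev_tgt]; exact entry_src_notMem)
      (by rw [Edge.rev_tgt]; exact entry_src_notMem)
    exact entry_injective (by simpa using congrArg Edge.rev this)
  have hex : ∀ y, y ∈ Finset.univ.filter (fun y => ¬ y ∈ crossers ω T) →
      ∃ y', Reach ω (strip n 0 T) (entry y) (entry y').rev := fun y hy =>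
    exists_uturn (Finset.mem_filter.1 hy).2
  have hback : ∀ y y', Reach ω (strip n 0 T) (entry y) (entry y').rev →
      Reach ω (strip n 0 T) (entry y') (entry y).rev := fun y y' h => by
    simpa using h.rev
  have hnot : ∑ y with ¬ y ∈ crossers ω T, φ y = 0 := by
    have hmem : ∀ y hy, (hex y hy).choose ∈ Finset.univ.filter (fun y => ¬ y ∈ crossers ω T) :=
      fun y hy => Finset.mem_filter.2 ⟨Finset.mem_univ _,
        notMem_crossers_of_uturn (hback _ _ (hex y hy).choose_spec)⟩
    refine Finset.sum_involution (fun y hy => (hex y hy).choose) ?_ ?_ hmem ?_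
    · intro y hy
      exact hU _ _ (hex y hy).choose_spec
    · intro y hy _ h
      have := (hex y hy).choose_spec
      rw [h] at this
      exact not_reach_rev _ this
    · intro y hy
      exact huniq _ _ _ (hex _ (hmem y hy)).choose_spec (hback _ _ (hex y hy).choose_spec)
  rw [← Finset.sum_filter_add_sum_filter_not Finset.univ (fun y => y ∈ crossers ω T) φ, hnot,
    add_zero] at hφ
  exact hφ

end Crossers

/-! ### Admissible states and the Manhattan orientation -/

/-- The states that the vertex `v` takes with positive probability. -/
def Allowed {Y : Type} [CommRing Y] (m : Model) (v : Vertex Y) (s : Site) : Prop :=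
  open Classical in
  match m with
  | .lorentz => True
  | .manhattan => s = .empty ∨ s = if Even ((v.1 : Y) - v.2) then .nw else .ne

section Parity

variable {n : ℕ}

lemma even_intCast_zmod (k : ℤ) : Even (k : ZMod (2 * n)) ↔ Even k := by
  constructor
  · rintro ⟨r, hr⟩
    obtain ⟨r, rfl⟩ := ZMod.intCast_surjective r
    have h : ((k - (r + r) : ℤ) : ZMod (2 * n)) = 0 := by
      push_cast
      rw [hr, sub_self]
    rw [ZMod.intCast_zmod_eq_zero_iff_dvd] at h
    have h2 : (2 : ℤ) ∣ k - (r + r) := dvd_trans ⟨(n : ℤ), by push_cast; ring⟩ h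
    rw [even_iff_two_dvd]
    omega
  · rintro ⟨r, rfl⟩
    exact ⟨r, by push_cast; rfl⟩

lemma even_add_one_zmod (y : ZMod (2 * n)) : Even (y + 1) ↔ ¬ Even y := by
  obtain ⟨k, rfl⟩ := ZMod.intCast_surjective y
  have := even_intCast_zmod (n := n) (k + 1)
  push_cast at this
  rw [this, even_intCast_zmod, Int.even_add_one]

lemma even_sub_one_zmod (y : ZMod (2 * n)) : Even (y - 1) ↔ ¬ Even y := by
  have := even_add_one_zmod (y - 1)
  rw [sub_add_cancel] at this
  tauto

lemma even_sub_zmod (x : ℤ) (y : ZMod (2 * n)) :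
    Even ((x : ZMod (2 * n)) - y) ↔ (Even x ↔ Even y) := by
  obtain ⟨k, rfl⟩ := ZMod.intCast_surjective y
  have := even_intCast_zmod (n := n) (x - k)
  push_cast at this
  rw [this, even_intCast_zmod, Int.even_sub]

/-- The edges that agree with the Manhattan orientation, in which even rows point east, odd rows
west, odd columns north and even columns south. Light in the Manhattan model either always or never
agrees with it. -/
def Oriented (e : Edge (ZMod (2 * n))) : Prop :=
  match e.dir with
  | .east => Even e.src.2
  | .north => ¬ Even e.src.1
  | .west => ¬ Even e.src.2
  | .south => Even e.src.1

lemma oriented_rev (e : Edge (ZMod (2 * n))) : Oriented e.rev ↔ ¬ Oriented e := by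
  obtain ⟨⟨a, b⟩, d⟩ := e
  cases d <;> simp [Oriented, Edge.rev, Edge.tgt, Direction.opp]

lemma oriented_step {ω : Config (ZMod (2 * n))} {e : Edge (ZMod (2 * n))}
    (h : Allowed .manhattan e.tgt (ω e.tgt)) : Oriented (step ω e) ↔ Oriented e := by
  classical
  obtain ⟨⟨a, b⟩, d⟩ := e
  unfold step
  generalize ω (Edge.tgt ⟨(a, b), d⟩) = s at h ⊢
  have ha : Even (a + 1) ↔ ¬ Even a := Int.even_add_one
  have ha' : Even (a - 1) ↔ ¬ Even a := by rw [Int.even_sub_one]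
  have hb : Odd b ↔ ¬ Even b := by simpa using even_add_one_zmod b
  simp only [Allowed] at h
  cases d <;> simp only [Edge.tgt, even_sub_zmod, even_add_one_zmod, even_sub_one_zmod, ha, ha']
    at h ⊢ <;>
  rcases h with rfl | rfl <;>
  by_cases hA : Even a <;> by_cases hB : Even b <;>
  simp [Oriented, Site.turn, hA, hB, hb, ha, ha']

/-- A sufficient condition for light that has crossed `e` to be sent along `f` by an admissible
state of the vertex between `e` and `f`. -/
def Linkable (m : Model) (e f : Edge (ZMod (2 * n))) : Prop :=
  match m with
  | .lorentz => f ≠ e.rev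
  | .manhattan => Oriented e ∧ Oriented f

lemma Linkable.exists_turn {m : Model} {e f : Edge (ZMod (2 * n))} (h : Linkable m e f)
    (hs : f.src = e.tgt) : ∃ s, Allowed m e.tgt s ∧ s.turn e.dir = f.dir := by
  classical
  obtain ⟨v, d'⟩ := f
  obtain rfl : v = e.tgt := hs
  obtain ⟨⟨a, b⟩, d⟩ := e
  cases m
  · have h' : d' ≠ d.opp := fun h' => h (by rw [h']; rfl)
    suffices ∃ s : Site, s.turn d = d' from this.imp fun s hs => ⟨trivial, hs⟩
    cases d <;> cases d' <;>
      first
      | exact absurd rfl h'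
      | exact ⟨.empty, rfl⟩
      | exact ⟨.nw, rfl⟩
      | exact ⟨.ne, rfl⟩
  · obtain ⟨h1, h2⟩ := h
    have ha : Even (a + 1) ↔ ¬ Even a := Int.even_add_one
    have ha' : Even (a - 1) ↔ ¬ Even a := by rw [Int.even_sub_one]
    by_cases hdd : d' = d
    · exact ⟨.empty, .inl rfl, hdd.symm⟩
    · refine ⟨_, .inr rfl, ?_⟩
      cases d <;> cases d' <;>
        simp only [Oriented, Edge.tgt, even_sub_zmod, even_add_one_zmod, even_sub_one_zmod, ha, ha']
          at h1 h2 ⊢ <;>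
        by_cases hA : Even a <;> by_cases hB : Even b <;>
        simp_all [Site.turn, -Int.not_even_iff_odd]

end Parity

/-! ### Reconnecting two paths along a closed orbit -/

section Surgery

variable {n : ℕ} {m : Model} {ω : Config (ZMod (2 * n))} {S : Set (Vertex (ZMod (2 * n)))}
  {a b e f g : Edge (ZMod (2 * n))} {N : ℕ}

open Classical in
/-- If the light from `a` and from `b` meets a closed orbit, first at the end of `e` and of `f`
respectively, then changing the states of these two vertices makes the light from `a` follow the
closed orbit for a while and then run back to `b`. -/
lemma exists_reconnection (hN : 0 < N) (hg : (step ω)^[N] g = g) (hS : orbitVertices ω g ⊆ S)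
    (ha : Reach ω (S ∩ (orbitVertices ω g)ᶜ) a e) (hb : Reach ω (S ∩ (orbitVertices ω g)ᶜ) b f)
    (he : e.tgt ∈ orbitVertices ω g) (hf : f.tgt ∈ orbitVertices ω g)
    (h₁ : ∀ i, ((step ω)^[i] g).src = e.tgt → Linkable m e ((step ω)^[i] g))
    (h₂ : ∀ i, ((step ω)^[i] g).tgt = f.tgt → Linkable m ((step ω)^[i] g) f.rev)
    (h₃ : Linkable m e f.rev) :
    ∃ s₁ s₂, Allowed m e.tgt s₁ ∧ Allowed m f.tgt s₂ ∧
      Reach (Function.update (Function.update ω e.tgt s₁) f.tgt s₂) S a b.rev := by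
  by_cases hef : e.tgt = f.tgt
  · obtain ⟨s, hs, hturn⟩ := h₃.exists_turn hef.symm
    refine ⟨s, s, hs, hef ▸ hs, ?_⟩
    rw [← hef, Function.update_idem]
    have hω : ∀ v ∈ S ∩ (orbitVertices ω g)ᶜ, ω v = Function.update ω e.tgt s v := by
      intro v hv
      rw [Function.update_of_ne]
      rintro rfl
      exact hv.2 he
    have hstep : step (Function.update ω e.tgt s) e = f.rev := by
      ext1
      · exact hef
      · simpa [step] using hturn
    have h1 := ((ha.congr hω).mono Set.inter_subset_left).tail (hS he)
    rw [hstep] at h1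
    exact h1.trans ((hb.rev.congr hω).mono Set.inter_subset_left)
  -- A shortest arc of the orbit from the first vertex to the second one avoids both in between.
  have hex : ∃ d i, ((step ω)^[i] g).tgt = e.tgt ∧ ((step ω)^[i + d] g).tgt = f.tgt := by
    obtain ⟨i, hi⟩ := he
    obtain ⟨j, hj⟩ := hf
    refine ⟨j + N * i - i, i, hi, ?_⟩
    have : i ≤ N * i := Nat.le_mul_of_pos_left i hN
    rw [show i + (j + N * i - i) = j + N * i by omega, Function.iterate_add_apply,
      Function.iterate_mul, Function.iterate_fixed hg, hj]
  obtain ⟨i, hi, hid⟩ := Nat.find_spec hex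
  have hmin := fun k => Nat.find_min hex (m := k)
  set d := Nat.find hex with hd
  have hd0 : d ≠ 0 := by
    intro h0
    rw [h0, add_zero, hi] at hid
    exact hef hid
  have hmid : ∀ c, 0 < c → c < d →
      ((step ω)^[i + c] g).tgt ≠ e.tgt ∧ ((step ω)^[i + c] g).tgt ≠ f.tgt := by
    intro c hc hcd
    constructor
    · intro h
      exact hmin (d - c) (by omega) ⟨i + c, h, by rw [show i + c + (d - c) = i + d by omega, hid]⟩
    · intro h
      exact hmin c hcd ⟨i, hi, h⟩
  have hsrc : ((step ω)^[i + 1] g).src = e.tgt := by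
    rw [Function.iterate_succ_apply', step_src, hi]
  obtain ⟨s₁, hs₁, ht₁⟩ := (h₁ _ hsrc).exists_turn hsrc
  obtain ⟨s₂, hs₂, ht₂⟩ := (h₂ _ hid).exists_turn (by rw [Edge.rev_src, hid])
  rw [hid] at hs₂
  refine ⟨s₁, s₂, hs₁, hs₂, ?_⟩
  set ω' := Function.update (Function.update ω e.tgt s₁) f.tgt s₂ with hω'
  have hω : ∀ v, v ≠ e.tgt → v ≠ f.tgt → ω v = ω' v := by
    intro v h1 h2
    rw [hω', Function.update_of_ne h2, Function.update_of_ne h1]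
  have hω2 : ∀ v ∈ S ∩ (orbitVertices ω g)ᶜ, ω v = ω' v := by
    rintro v ⟨-, hv⟩
    refine hω v ?_ ?_
    · rintro rfl; exact hv he
    · rintro rfl; exact hv hf
  have hstep₁ : step ω' e = (step ω)^[i + 1] g := by
    ext1
    · exact hsrc.symm
    · rw [← ht₁, step, hω', Function.update_of_ne hef, Function.update_self]
  have hstep₂ : step ω' ((step ω)^[i + d] g) = f.rev := by
    ext1
    · exact hid
    · rw [← ht₂, step, hid, hω', Function.update_self]
  have harc : Reach ω {v | v ∈ orbitVertices ω g ∧ v ≠ e.tgt ∧ v ≠ f.tgt} ((step ω)^[i + 1] g)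
      ((step ω)^[i + d] g) := by
    refine reach_iff_iterate.2 ⟨d - 1, ?_, ?_⟩
    · rw [← Function.iterate_add_apply, show d - 1 + (i + 1) = i + d by omega]
    · intro c hc
      rw [← Function.iterate_add_apply, show c + (i + 1) = i + (c + 1) by omega]
      exact ⟨tgt_mem_orbitVertices _ _ _, hmid (c + 1) (by omega) (by omega)⟩
  have p1 := ((ha.congr hω2).mono Set.inter_subset_left).tail (hS he)
  rw [hstep₁] at p1
  have p2 := p1.trans ((harc.congr fun v hv => hω v hv.2.1 hv.2.2).mono fun v hv => hS hv.1)
  have p3 := p2.tail (hS (tgt_mem_orbitVertices _ _ _))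
  rw [hstep₂] at p3
  exact p3.trans ((hb.rev.congr hω2).mono Set.inter_subset_left)

lemma orbitVertices_rev (hN : 0 < N) (hg : (step ω)^[N] g = g) :
    (step ω)^[N] g.rev = g.rev ∧ orbitVertices ω g.rev = orbitVertices ω g := by
  have key : ∀ g, (step ω)^[N] g = g →
      (step ω)^[N] g.rev = g.rev ∧ orbitVertices ω g.rev ⊆ orbitVertices ω g := by
    intro g hg
    constructor
    · have := iterate_step_rev ω g N
      rwa [hg] at this
    · rintro _ ⟨i, rfl⟩
      have hi : i ≤ N * i := Nat.le_mul_of_pos_left i hN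
      have h1 := iterate_step_rev_of_le ω g hi
      rw [Function.iterate_mul, Function.iterate_fixed hg] at h1
      rw [h1, Edge.rev_tgt]
      exact src_mem_orbitVertices hN hg _
  have h1 := key g hg
  refine ⟨h1.1, h1.2.antisymm ?_⟩
  have h2 := key g.rev h1.1
  rw [Edge.rev_rev] at h2
  exact h2.2

lemma Reach.oriented_iff (h : Reach ω S e f) (hω : ∀ v, Allowed .manhattan v (ω v)) :
    Oriented f ↔ Oriented e := by
  induction h with
  | refl => rfl
  | tail _ hbc ih =>
    rw [← ih, hbc.2]
    exact oriented_step (hω _)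

/-- If some light crosses, then so does light along two different paths, which in the Manhattan
model can be chosen with opposite orientations. -/
lemma exists_pair_crossers [NeZero n] {T : ℤ} (hω : ∀ v, Allowed m v (ω v))
    (hne : (crossers ω T).Nonempty) :
    ∃ y ∈ crossers ω T, ∃ y' ∈ crossers ω T, y ≠ y' ∧
      (m = .manhattan → Oriented (entry y) ∧ ¬ Oriented (entry y')) := by
  classical
  obtain ⟨y₀, hy₀⟩ := hne
  cases m
  · have h := sum_crossers_eq_zero (ω := ω) (T := T) (R := ZMod 2) (fun _ => 1)
      (by simp [ZMod.card, show ((2 : ZMod 2)) = 0 from rfl]) (fun _ _ _ => rfl)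
    rw [Finset.sum_const, nsmul_eq_mul, mul_one, ZMod.natCast_eq_zero_iff] at h
    have hpos : 0 < (Finset.univ.filter fun y => y ∈ crossers ω T).card :=
      Finset.card_pos.2 ⟨y₀, by simpa using hy₀⟩
    obtain ⟨y, hy, y', hy', hyy⟩ := Finset.one_lt_card.1 (show 1 < _ from
      lt_of_lt_of_le one_lt_two (Nat.le_of_dvd hpos h))
    exact ⟨y, by simpa using hy, y', by simpa using hy', hyy, fun h => nomatch h⟩
  · have h := sum_crossers_eq_zero (ω := ω) (T := T) (R := ℤ)
      (fun y => if Even y then 1 else -1) ?_ ?_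
    · have hE : ∃ y ∈ crossers ω T, Even y := by
        by_contra! hcon
        have hlt : ∑ y with y ∈ crossers ω T, (if Even y then (1 : ℤ) else -1) < 0 := by
          refine Finset.sum_neg (fun y hy => ?_) ⟨y₀, by simpa using hy₀⟩
          rw [if_neg (hcon y (by simpa using hy))]
          norm_num
        omega
      have hO : ∃ y ∈ crossers ω T, ¬ Even y := by
        by_contra! hcon
        have hlt : 0 < ∑ y with y ∈ crossers ω T, (if Even y then (1 : ℤ) else -1) := by
          refine Finset.sum_pos (fun y hy => ?_) ⟨y₀, by simpa using hy₀⟩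
          rw [if_pos (hcon y (by simpa using hy))]
          norm_num
        omega
      obtain ⟨y, hy, hyE⟩ := hE
      obtain ⟨y', hy', hyO⟩ := hO
      refine ⟨y, hy, y', hy', ?_, fun _ => ⟨hyE, hyO⟩⟩
      rintro rfl
      exact hyO hyE
    · have h1 := Equiv.sum_comp (Equiv.addRight (1 : ZMod (2 * n)))
        fun y => if Even y then (1 : ℤ) else -1
      have h2 : ∀ y : ZMod (2 * n), (if Even (Equiv.addRight 1 y) then (1 : ℤ) else -1)
          = -(if Even y then (1 : ℤ) else -1) := by
        intro y
        simp only [Equiv.coe_addRight, even_add_one_zmod]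
        split_ifs <;> simp_all
      rw [Finset.sum_congr rfl fun y _ => h2 y, Finset.sum_neg_distrib] at h1
      omega
    · intro y y' hyy
      have h1 := hyy.oriented_iff hω
      rw [oriented_rev] at h1
      have h2 : ¬ Even y' ↔ Even y := h1
      by_cases hy : Even y <;> simp_all

open Classical in
/-- If some light crosses up to the column `T`, and there is a closed orbit of winding number one to
the left of `T`, then changing the states of at most two vertices of this orbit stops some of the
crossing light. -/
theorem exists_surgery [NeZero n] {t T : ℤ} (ht : 0 ≤ t) (hω : ∀ v, Allowed m v (ω v))
    (hne : (crossers ω T).Nonempty) (hN : 0 < N) (hg : (step ω)^[N] g = g)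
    (hcol : orbitVertices ω g ⊆ strip n t T) (hflow : totalFlow ω g N (T, 0) = 1) :
    ∃ v₁ ∈ strip n t T, ∃ v₂ ∈ strip n t T, ∃ s₁ s₂, Allowed m v₁ s₁ ∧ Allowed m v₂ s₂ ∧
      ∃ y ∈ crossers ω T,
        y ∉ crossers (Function.update (Function.update ω v₁ s₁) v₂ s₂) T := by
  obtain ⟨y, hy, y', hy', hyy, hor⟩ := exists_pair_crossers hω hne
  have hsub : strip n t T ⊆ strip n 0 T := fun v hv => by
    have h1 := hv.1
    have h2 := hv.2
    rw [mem_strip_zero]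
    omega
  have hhit : ∀ y ∈ crossers ω T, ∃ e, Reach ω (strip n 0 T ∩ (orbitVertices ω g)ᶜ) (entry y) e ∧
      e.tgt ∈ orbitVertices ω g ∧ e.src ∉ orbitVertices ω g := by
    intro y hy
    obtain ⟨f, hf, hT⟩ := mem_crossers_iff.1 hy
    rcases hf.inter_or_exit (orbitVertices ω g)ᶜ with h | ⟨e, h, -, h2⟩
    · exact absurd Set.inter_subset_right
        (h.exists_mem_orbitVertices hN hg hcol hflow (by simpa [entry] using ht) hT)
    · refine ⟨e, h, not_not.1 h2.2, ?_⟩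
      rcases h.src_mem with rfl | h3
      · exact fun h => entry_src_notMem (hsub (hcol h))
      · exact h3.2
  obtain ⟨e, he, hte, hse⟩ := hhit y hy
  obtain ⟨f, hf, htf, hsf⟩ := hhit y' hy'
  -- In the Manhattan model the orbit is run through in the direction of the orientation.
  obtain ⟨g', hg', hV, horg⟩ : ∃ g', (step ω)^[N] g' = g' ∧
      orbitVertices ω g' = orbitVertices ω g ∧ (m = .manhattan → Oriented g') := by
    by_cases h : Oriented g
    · exact ⟨g, hg, rfl, fun _ => h⟩
    · obtain ⟨h1, h2⟩ := orbitVertices_rev hN hg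
      exact ⟨g.rev, h1, h2, fun _ => (oriented_rev g).2 h⟩
  rw [← hV] at he hte hse hf htf hsf hcol
  have hef : e ≠ f := by
    rintro rfl
    have hnot : ∀ z : ZMod (2 * n), (entry z).rev.tgt ∉ strip n 0 T ∩ (orbitVertices ω g')ᶜ := by
      intro z h
      rw [Edge.rev_tgt] at h
      exact entry_src_notMem h.1
    have := he.rev.exit_unique hf.rev (hnot _) (hnot _)
    exact hyy (entry_injective (by simpa using congrArg Edge.rev this))
  have horb : m = .manhattan → ∀ i, Oriented ((step ω)^[i] g') := by
    rintro rfl i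
    induction i with
    | zero => exact horg rfl
    | succ i ih =>
      rw [Function.iterate_succ_apply']
      exact (oriented_step (hω _)).2 ih
  obtain ⟨s₁, s₂, hs₁, hs₂, hreach⟩ := exists_reconnection (m := m) hN hg' (hcol.trans hsub) he hf
    hte htf (by
      intro i hi
      cases m
      · intro h
        apply hse
        rw [← Edge.rev_tgt e, ← h]
        exact tgt_mem_orbitVertices _ _ _
      · exact ⟨(he.oriented_iff hω).2 (hor rfl).1, horb rfl i⟩)
    (by
      intro i hi
      cases m
      · intro h
        apply hsf
        rw [← Edge.rev_rev f, h, Edge.rev_rev]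
        exact src_mem_orbitVertices hN hg' _
      · exact ⟨horb rfl i, (oriented_rev f).2 fun h => (hor rfl).2 ((hf.oriented_iff hω).1 h)⟩)
    (by
      cases m
      · intro h
        exact hef (by simpa using (congrArg Edge.rev h).symm)
      · exact ⟨(he.oriented_iff hω).2 (hor rfl).1,
          (oriented_rev f).2 fun h => (hor rfl).2 ((hf.oriented_iff hω).1 h)⟩)
  exact ⟨e.tgt, hcol hte, f.tgt, hcol htf, s₁, s₂, hs₁, hs₂, y, hy,
    notMem_crossers_of_uturn hreach⟩

end Surgery

/-! ### Events that depend on finitely many vertices -/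

instance : DiscreteMeasurableSpace Site := ⟨fun _ => trivial⟩

instance : Finite Site :=
  Set.finite_univ_iff.1 <| (Set.toFinite {Site.empty, Site.nw, Site.ne}).subset fun s _ => by
    cases s <;> simp

section Events

open ProbabilityTheory

variable {ι κ : Type*} {μ : ι → Measure Site} [∀ i, IsProbabilityMeasure (μ i)]
  {ν : κ → Measure Site} [∀ i, IsProbabilityMeasure (ν i)]
  {S S' : Set ι} {E E' : Set (ι → Site)}

lemma preimage_domRestrict_image (hE : DependsOn (fun ω => ω ∈ E) S) :
    S.domRestrict ⁻¹' (S.domRestrict '' E) = E := by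
  refine (Set.subset_preimage_image _ _).antisymm' ?_
  rintro ω ⟨ω', hω', h⟩
  have := hE (x := ω) (y := ω') fun i hi => (congrFun h ⟨i, hi⟩).symm
  exact this.mpr hω'

lemma measurableSet_of_dependsOn (hS : S.Finite) (hE : DependsOn (fun ω => ω ∈ E) S) :
    MeasurableSet E := by
  have := hS.to_subtype
  rw [← preimage_domRestrict_image hE]
  exact (Set.toFinite (S.domRestrict '' E)).measurableSet.preimage (by fun_prop)

/-- Events that depend on disjoint finite sets of vertices are independent. -/
lemma real_inter_of_dependsOn (hS : S.Finite) (hS' : S'.Finite) (hd : Disjoint S S')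
    (hE : DependsOn (fun ω => ω ∈ E) S) (hE' : DependsOn (fun ω => ω ∈ E') S') :
    (Measure.infinitePi μ).real (E ∩ E')
      = (Measure.infinitePi μ).real E * (Measure.infinitePi μ).real E' := by
  have h1 : iIndepFun (fun i (ω : ι → Site) => ω i) (Measure.infinitePi μ) :=
    iIndepFun_infinitePi (X := fun _ ω => ω) fun _ => measurable_id
  have h2 := h1.indepFun_finset hS.toFinset hS'.toFinset (by simpa using hd)
    fun i => measurable_pi_apply i
  have key : ∀ {S : Set ι} (hS : S.Finite) {E : Set (ι → Site)},
      DependsOn (fun ω => ω ∈ E) S → ∃ A : Set (hS.toFinset → Site), MeasurableSet A ∧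
        (fun ω (i : hS.toFinset) => ω i) ⁻¹' A = E := by
    intro S hS E hE
    refine ⟨(fun ω (i : hS.toFinset) => ω i) '' E, (Set.toFinite _).measurableSet, ?_⟩
    refine (Set.subset_preimage_image _ _).antisymm' ?_
    rintro ω ⟨ω', hω', h⟩
    have := hE (x := ω) (y := ω') fun i hi => (congrFun h ⟨i, by simpa using hi⟩).symm
    exact this.mpr hω'
  obtain ⟨A, hA, rfl⟩ := key hS hE
  obtain ⟨A', hA', rfl⟩ := key hS' hE'
  have := (indepFun_iff_measure_inter_preimage_eq_mul.1 h2) A A' hA hA'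
  simp only [measureReal_def, this, ENNReal.toReal_mul]

/-- Change of variables: reading off the states of the vertices through an injective map `ψ` and
applying `g` to them gives an event of the same probability, if the laws of single states agree. -/
lemma real_reindex {ψ : κ → ι} {g : Site → Site} {S : Set κ} {E : Set (κ → Site)} (hS : S.Finite)
    (hE : DependsOn (fun ω => ω ∈ E) S) (hψ : Set.InjOn ψ S)
    (hlaw : ∀ v ∈ S, (μ (ψ v)).map g = ν v) :
    (Measure.infinitePi μ).real {ω | (fun v => g (ω (ψ v))) ∈ E}
      = (Measure.infinitePi ν).real E := by
  have := hS.to_subtype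
  have hg : Measurable g := Measurable.of_discrete
  set A := S.domRestrict '' E with hA
  have hAm : MeasurableSet A := (Set.toFinite A).measurableSet
  have h1 : (Measure.infinitePi ν) E = (Measure.infinitePi fun v : S => ν v) A := by
    rw [← Measure.infinitePi_map_restrict' (μ := ν), Measure.map_apply (by fun_prop) hAm, hA,
      preimage_domRestrict_image hE]
  have h2 : {ω : ι → Site | (fun v => g (ω (ψ v))) ∈ E}
      = (fun ω (v : S) => g (ω (ψ v))) ⁻¹' A := by
    conv_lhs => rw [← preimage_domRestrict_image hE]
    rfl
  have h3 : (Measure.infinitePi μ).map (fun ω (v : S) => g (ω (ψ v)))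
      = Measure.infinitePi fun v : S => ν v := by
    have hinj : Function.Injective fun v : S => ψ v := hψ.injective
    have h4 := Measure.infinitePi_map_pi (μ := fun v : S => μ (ψ v)) (f := fun _ => g)
      fun _ => hg
    rw [← Measure.map_infinitePi_infinitePi_of_inj hinj, Measure.map_map (by fun_prop)
      (by fun_prop)] at h4
    simp only [fun v : S => hlaw v v.2] at h4
    exact h4
  rw [measureReal_def, measureReal_def, h1, h2, ← h3, Measure.map_apply (by fun_prop) hAm]

/-- Forcing the state of one vertex increases the probability of an event at most by the factor
`1 / μ v {s}`. -/
lemma real_update_mul_le [DecidableEq ι] (hS : S.Finite) (hE : DependsOn (fun ω => ω ∈ E) S)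
    (v : ι) (s : Site) :
    (Measure.infinitePi μ).real {ω | Function.update ω v s ∈ E} * (μ v).real {s}
      ≤ (Measure.infinitePi μ).real E := by
  have h1 : DependsOn (fun ω => ω ∈ {ω : ι → Site | Function.update ω v s ∈ E}) (S \ {v}) := by
    intro ω ω' h
    refine hE fun i hi => ?_
    by_cases hiv : i = v
    · subst hiv
      simp
    · rw [Function.update_of_ne hiv, Function.update_of_ne hiv]
      exact h i ⟨hi, hiv⟩
  have h2 : DependsOn (fun ω => ω ∈ {ω : ι → Site | ω v = s}) {v} := by
    intro ω ω' h
    have := h v rfl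
    simp [this]
  have h3 : (Measure.infinitePi μ).real {ω | ω v = s} = (μ v).real {s} := by
    have := (measurePreserving_eval_infinitePi μ v).measure_preimage
      (s := {s}) (MeasurableSet.singleton s).nullMeasurableSet
    rw [measureReal_def, measureReal_def, ← this]
    rfl
  rw [← h3, ← real_inter_of_dependsOn (hS.sdiff) (Set.finite_singleton v)
    Set.disjoint_sdiff_left h1 h2]
  refine measureReal_mono ?_
  rintro ω ⟨h4, h5⟩
  have : Function.update ω v s = ω := by
    rw [← h5]
    exact Function.update_eq_self v ω
  rw [Set.mem_ofPred_eq, this] at h4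
  exact h4

lemma dependsOn_update [DecidableEq ι] (hE : DependsOn (fun ω => ω ∈ E) S) (v : ι) (s : Site) :
    DependsOn (fun ω => ω ∈ {ω : ι → Site | Function.update ω v s ∈ E}) S := by
  intro ω ω' h
  refine hE fun i hi => ?_
  by_cases hiv : i = v
  · subst hiv
    simp
  · rw [Function.update_of_ne hiv, Function.update_of_ne hiv]
    exact h i hi

end Events

/-! ### The law of a single vertex -/

section SiteLaw

variable {m : Model} {p : unitInterval} {Y Y' : Type} [CommRing Y] [CommRing Y']

instance : IsProbabilityMeasure (law Y m p) := by
  unfold law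
  infer_instance

/-- The exchange of the two types of mirrors. -/
def Site.flip : Site → Site
  | .empty => .empty
  | .nw => .ne
  | .ne => .nw

lemma siteLaw_congr {v : Vertex Y} {w : Vertex Y'}
    (h : Even ((v.1 : Y) - v.2) ↔ Even ((w.1 : Y') - w.2)) : siteLaw m p v = siteLaw m p w := by
  classical
  cases m
  · rfl
  · simp only [siteLaw, h]

lemma siteLaw_map_flip {v : Vertex Y} {w : Vertex Y'}
    (h : Even ((v.1 : Y) - v.2) ↔ ¬ Even ((w.1 : Y') - w.2)) :
    (siteLaw m p v).map Site.flip = siteLaw m p w := by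
  classical
  have hm : Measurable Site.flip := Measurable.of_discrete
  cases m
  · simp only [siteLaw, Measure.map_add _ _ hm, Measure.map_smul, Measure.map_dirac' hm, Site.flip]
    rw [add_right_comm]
  · simp only [siteLaw, Measure.map_add _ _ hm, Measure.map_smul, Measure.map_dirac' hm, h]
    split_ifs <;> rfl

lemma le_siteLaw_of_allowed (v : Vertex Y) {s : Site} (h : Allowed m v s) :
    min (1 - (p : ℝ)) (p / 2) ≤ (siteLaw m p v).real {s} := by
  classical
  have h0 : (0 : ℝ) ≤ p := p.2.1
  have h1 : (0 : ℝ) ≤ 1 - p := sub_nonneg.2 p.2.2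
  have h2 : (0 : ℝ) ≤ p / 2 := by positivity
  have key : ∀ {q : ℝ}, 0 ≤ q → ENNReal.ofReal q ≤ siteLaw m p v {s} →
      q ≤ (siteLaw m p v).real {s} := fun {q} hq h =>
    (ENNReal.ofReal_le_iff_le_toReal (measure_ne_top _ _)).1 h
  cases m
  · cases s
    · refine (min_le_left _ _).trans (key h1 ?_)
      simp [siteLaw]
    · refine (min_le_right _ _).trans (key h2 ?_)
      simp [siteLaw]
    · refine (min_le_right _ _).trans (key h2 ?_)
      simp [siteLaw]
  · rcases h with rfl | rfl
    · refine (min_le_left _ _).trans (key h1 ?_)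
      simp [siteLaw]
    · refine (min_le_right _ _).trans (le_trans (by linarith) (key h0 ?_))
      simp [siteLaw]

lemma ae_allowed (n : ℕ) : ∀ᵐ ω ∂(law (ZMod (2 * n)) m p), ∀ v, Allowed m v (ω v) := by
  classical
  have : Countable (ZMod (2 * n)) := by
    have := ZMod.intCast_surjective (n := 2 * n)
    exact this.countable
  rw [ae_all_iff]
  intro v
  have h1 : ∀ᵐ s ∂(siteLaw m p v), Allowed m v s := by
    cases m
    · exact Filter.Eventually.of_forall fun _ => trivial
    · simp only [siteLaw]
      rw [ae_add_measure_iff]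
      constructor
      · refine Measure.ae_smul_measure ?_ _
        rw [ae_dirac_eq]
        exact .inl rfl
      · refine Measure.ae_smul_measure ?_ _
        rw [ae_dirac_eq]
        exact .inr rfl
  exact (measurePreserving_eval_infinitePi (fun v => siteLaw m p v) v).quasiMeasurePreserving.ae h1

end SiteLaw

/-! ### From crossings of a plane box to closed orbits on the cylinder -/

section Trajectories

variable {Y : Type} [CommRing Y] {ω : Config Y}

lemma Trajectory.getElem_edges (L : Trajectory ω) (i : ℕ) (hi : i < L.edges.length) :
    L.edges[i] = (step ω)^[i] L.initialEdge := by
  induction i with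
  | zero => simp [Trajectory.initialEdge, List.head_eq_getElem]
  | succ i ih =>
    have h := List.isChain_iff_getElem.1 L.chain i hi
    rw [Function.iterate_succ_apply', ← ih (by omega)]
    ext1
    · exact h.1
    · exact h.2

lemma Trajectory.exists_iterate_src (L : Trajectory ω) {v : Vertex Y} (hv : v ∈ L.vertices) :
    ∃ i, ((step ω)^[i] L.initialEdge).src = v := by
  obtain ⟨e, he, h⟩ := hv
  obtain ⟨i, hi, rfl⟩ := List.getElem_of_mem he
  rw [L.getElem_edges] at h
  rcases h with rfl | rfl
  · exact ⟨i, rfl⟩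
  · exact ⟨i + 1, by rw [Function.iterate_succ_apply', step_src]⟩

/-- Paths are transported by maps that are compatible with the dynamics. -/
lemma Reach.map {Y' : Type} [CommRing Y'] {ω' : Config Y'} {S : Set (Vertex Y)}
    {S' : Set (Vertex Y')} {e f : Edge Y} (h : Reach ω S e f) (F : Edge Y → Edge Y')
    (ψ : Vertex Y → Vertex Y') (hF : ∀ e, (F e).tgt = ψ e.tgt)
    (hstep : ∀ e, step ω' (F e) = F (step ω e)) (hS : Set.MapsTo ψ S S') :
    Reach ω' S' (F e) (F f) := by
  induction h with
  | refl => exact Reach.refl _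
  | tail _ hbc ih =>
    rw [hbc.2, ← hstep]
    exact ih.tail (by rw [hF]; exact hS hbc.1)

lemma dependsOn_reach (S : Set (Vertex Y)) (e f : Edge Y) :
    DependsOn (fun ω => ω ∈ {ω | Reach ω S e f}) S := by
  intro ω ω' h
  exact propext ⟨fun h' => h'.congr h, fun h' => h'.congr fun v hv => (h v hv).symm⟩

lemma dependsOn_reindex {ι κ : Type*} {E : Set (κ → Site)} {S : Set κ} {S' : Set ι}
    (hE : DependsOn (fun ω => ω ∈ E) S) (ψ : κ → ι) (g : Site → Site) (hψ : Set.MapsTo ψ S S') :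
    DependsOn (fun ω => ω ∈ {ω : ι → Site | (fun v => g (ω (ψ v))) ∈ E}) S' := by
  intro ω ω' h
  refine hE fun v hv => ?_
  simp only [h _ (hψ hv)]

lemma dependsOn_inter {ι : Type*} {E E' : Set (ι → Site)} {S S' : Set ι}
    (hE : DependsOn (fun ω => ω ∈ E) S) (hE' : DependsOn (fun ω => ω ∈ E') S') :
    DependsOn (fun ω => ω ∈ E ∩ E') (S ∪ S') := by
  intro ω ω' h
  have h1 : (ω ∈ E) = (ω' ∈ E) := hE fun i hi => h i (.inl hi)
  have h2 : (ω ∈ E') = (ω' ∈ E') := hE' fun i hi => h i (.inr hi)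
  simp only [Set.mem_inter_iff, h1, h2]

end Trajectories

section Boxes

variable {n : ℕ} {m : Model} {p : unitInterval}

/-- The box of the crossing event. -/
def box (n : ℕ) : Set (Vertex ℤ) := Set.Icc 1 ((100 * n : ℕ) : ℤ) ×ˢ Set.Icc 1 (n : ℤ)

lemma box_finite : (box n).Finite := (Set.finite_Icc _ _).prod (Set.finite_Icc _ _)

/-- The event that the box is crossed by light that enters at the abscissa `x'` and leaves at the
abscissa `x`. -/
def boxPath (n : ℕ) (x' x : ℤ) : Set (Config ℤ) :=
  {ω | Reach ω (box n) ⟨(x', 0), .north⟩ ⟨(x, n), .north⟩}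

lemma boxCrossing_subset :
    boxCrossing (100 * n) n ⊆ ⋃ q ∈ Finset.Icc (1 : ℤ) ((100 * n : ℕ) : ℤ) ×ˢ
      Finset.Icc (1 : ℤ) ((100 * n : ℕ) : ℤ), boxPath n q.1 q.2 := by
  rintro ω ⟨L, ⟨x', hx', hi⟩, ⟨x, hx, ht⟩, hinn⟩
  rw [sub_self] at hi
  simp only [Set.mem_iUnion, exists_prop]
  refine ⟨(x', x), Finset.mem_product.2 ⟨Finset.mem_Icc.2 hx', Finset.mem_Icc.2 hx⟩, ?_⟩
  have hlen : 0 < L.edges.length := List.length_pos_iff.2 L.ne_nil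
  have hlast : (step ω)^[L.edges.length - 1] L.initialEdge = ⟨(x, n), .north⟩ := by
    rw [← L.getElem_edges _ (by omega), ← ht, Trajectory.terminalEdge, List.getLast_eq_getElem]
  have hinner : ∀ i, 0 < i → i < L.edges.length - 1 →
      (step ω)^[i] L.initialEdge ∈ L.edges.tail.dropLast := by
    intro i hi hi'
    rw [← L.getElem_edges i (by omega)]
    refine List.mem_iff_getElem.2 ⟨i - 1, by simp; omega, ?_⟩
    simp [Nat.sub_add_cancel hi]
  refine reach_iff_iterate.2 ⟨L.edges.length - 1, ?_, ?_⟩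
  · rw [← hi, hlast]
  · intro i hilt
    rw [← hi]
    rcases Nat.eq_zero_or_pos i with rfl | hpos
    · -- The vertex after the first edge is the first vertex of the second edge.
      have h1 : ((step ω)^[0] L.initialEdge).tgt = ((step ω)^[1] L.initialEdge).src := rfl
      rw [h1]
      by_cases h2 : 1 < L.edges.length - 1
      · exact hinn ⟨_, hinner 1 one_pos h2, .inl rfl⟩
      · obtain h3 : L.edges.length - 1 = 1 := by omega
        rw [h3] at hlast
        have h4 : ((step ω)^[1] L.initialEdge).src = (x', 0 + 1) := by
          rw [← h1, hi]
          rfl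
        rw [hlast] at h4 ⊢
        simp only [Prod.mk.injEq] at h4
        refine ⟨hx, ?_⟩
        simp only [Set.mem_Icc]
        omega
    · exact hinn ⟨_, hinner i hpos hilt, .inr rfl⟩

/-- One of the `(100 n) ^ 2` pairs of abscissas has a substantial probability of being joined by a
crossing. -/
lemma exists_boxPath [NeZero n] {c : ℝ} (hc : c ≤ (law ℤ m p).real (boxCrossing (100 * n) n)) :
    ∃ x' x, c / (100 * n) ^ 2 ≤ (law ℤ m p).real (boxPath n x' x) := by
  have hn : (0 : ℝ) < n := Nat.cast_pos.2 (NeZero.pos n)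
  by_contra! hcon
  set F := Finset.Icc (1 : ℤ) ((100 * n : ℕ) : ℤ) with hF
  have hcard : F.card = 100 * n := by rw [hF, Int.card_Icc]; omega
  have hne : (F ×ˢ F).Nonempty := by
    rw [← Finset.card_pos, Finset.card_product, hcard]
    have := NeZero.pos n
    positivity
  have : (law ℤ m p).real (boxCrossing (100 * n) n) < c := by
    calc (law ℤ m p).real (boxCrossing (100 * n) n)
        ≤ (law ℤ m p).real (⋃ q ∈ F ×ˢ F, boxPath n q.1 q.2) :=
          measureReal_mono boxCrossing_subset (measure_ne_top _ _)
      _ ≤ ∑ q ∈ F ×ˢ F, (law ℤ m p).real (boxPath n q.1 q.2) := measureReal_biUnion_finset_le _ _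
      _ < ∑ q ∈ F ×ˢ F, c / (100 * n) ^ 2 := Finset.sum_lt_sum_of_nonempty hne fun q _ => hcon _ _
      _ = c := by
        rw [Finset.sum_const, Finset.card_product, hcard, nsmul_eq_mul]
        push_cast
        field_simp
  linarith

/-- The map from the box to the lower half of the part `{t + 1, …, t + 100 n}` of the cylinder. -/
def lowerMap (n : ℕ) (t : ℤ) (v : Vertex ℤ) : Vertex (ZMod (2 * n)) :=
  (v.1 + t, (v.2 : ZMod (2 * n)))

/-- The map that reflects the box in a horizontal axis and puts it onto the upper half of the part
`{t + 1, …, t + 100 n}` of the cylinder. -/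
def upperMap (n : ℕ) (t : ℤ) (v : Vertex ℤ) : Vertex (ZMod (2 * n)) :=
  (v.1 + t, 1 - (v.2 : ZMod (2 * n)))

/-- The event that the part `{t + 1, …, t + 100 n}` of the cylinder contains a crossing of the lower
half and its mirror image in the upper half. -/
def windingEvent (n : ℕ) (t x' x : ℤ) : Set (Config (ZMod (2 * n))) :=
  {ω | (fun v => ω (lowerMap n t v)) ∈ boxPath n x' x} ∩
    {ω | (fun v => (ω (upperMap n t v)).flip) ∈ boxPath n x' x}

lemma intCast_zmod_inj_of_lt {a b : ℤ} (h : (a : ZMod (2 * n)) = b) (h1 : a - b < 2 * n)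
    (h2 : b - a < 2 * n) : a = b := by
  rw [ZMod.intCast_eq_intCast_iff_dvd_sub] at h
  have h0 := Int.eq_zero_of_abs_lt_dvd h (by push_cast; rw [abs_lt]; constructor <;> linarith)
  linarith

lemma lowerMap_mapsTo [NeZero n] (t : ℤ) :
    Set.MapsTo (lowerMap n t) (box n) (strip n t (t + 100 * n) ∩ lowerHalf n) := by
  rintro ⟨x, y⟩ ⟨hx, hy⟩
  simp only [Set.mem_Icc] at hx hy
  push_cast at hx
  refine ⟨⟨by simp only [lowerMap]; linarith, by simp only [lowerMap]; linarith⟩, ?_⟩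
  obtain ⟨k, rfl⟩ := Int.eq_ofNat_of_zero_le (show 0 ≤ y by linarith)
  have : ((k : ℤ) : ZMod (2 * n)).val = k := by
    rw [Int.cast_natCast, ZMod.val_natCast_of_lt (by omega)]
  simp only [lowerHalf, lowerMap, Set.mem_ofPred_eq, this]
  omega

lemma upperMap_mapsTo [NeZero n] (t : ℤ) :
    Set.MapsTo (upperMap n t) (box n) (strip n t (t + 100 * n) ∩ (lowerHalf n)ᶜ) := by
  rintro ⟨x, y⟩ ⟨hx, hy⟩
  simp only [Set.mem_Icc] at hx hy
  push_cast at hx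
  refine ⟨⟨by simp only [upperMap]; linarith, by simp only [upperMap]; linarith⟩, ?_⟩
  rintro ⟨h1, h2⟩
  simp only [upperMap] at h1 h2
  set r := (1 - (y : ZMod (2 * n))).val with hr
  have h3 : (((1 - y : ℤ) : ZMod (2 * n))) = ((r : ℤ) : ZMod (2 * n)) := by
    rw [hr, Int.cast_natCast, ZMod.natCast_zmod_val]
    push_cast
    rfl
  have := intCast_zmod_inj_of_lt h3 (by omega) (by omega)
  omega

lemma lowerMap_injOn (t : ℤ) : Set.InjOn (lowerMap n t) (box n) := by
  rintro ⟨x, y⟩ ⟨hx, hy⟩ ⟨x', y'⟩ ⟨hx', hy'⟩ h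
  simp only [Set.mem_Icc] at hx hy hx' hy'
  simp only [lowerMap, Prod.mk.injEq] at h
  have h1 := intCast_zmod_inj_of_lt h.2 (by omega) (by omega)
  rw [h1, show x = x' by linarith [h.1]]

lemma upperMap_injOn (t : ℤ) : Set.InjOn (upperMap n t) (box n) := by
  rintro ⟨x, y⟩ hv ⟨x', y'⟩ hv' h
  refine lowerMap_injOn t hv hv' ?_
  simp only [upperMap, lowerMap, Prod.mk.injEq, sub_right_inj] at h ⊢
  exact h

/-- The reflection of directions in a horizontal axis. -/
def Direction.vflip : Direction → Direction
  | .east => .east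
  | .north => .south
  | .west => .west
  | .south => .north

lemma Site.turn_vflip (s : Site) (d : Direction) : s.turn d.vflip = (s.flip.turn d).vflip := by
  cases s <;> cases d <;> rfl

/-- On the winding event there is a closed orbit of winding number one. -/
lemma exists_orbit_of_mem_windingEvent [NeZero n] {t x' x : ℤ} {ω : Config (ZMod (2 * n))}
    (hω : ω ∈ windingEvent n t x' x) :
    ∃ g : Edge (ZMod (2 * n)), ∃ N, 0 < N ∧ (step ω)^[N] g = g ∧
      orbitVertices ω g ⊆ strip n t (t + 100 * n) ∧ totalFlow ω g N (t + 100 * n, 0) = 1 := by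
  obtain ⟨h₁, h₂⟩ := hω
  have p₁ := Reach.map (ω' := ω) h₁ (fun e => ⟨lowerMap n t e.src, e.dir⟩) (lowerMap n t)
    (by
      rintro ⟨⟨a, b⟩, d⟩
      cases d <;> simp [Edge.tgt, lowerMap] <;> ring)
    (by
      rintro ⟨⟨a, b⟩, d⟩
      cases d <;> simp [step, Edge.tgt, lowerMap, add_right_comm, sub_add_eq_add_sub])
    (lowerMap_mapsTo t)
  have p₂ := Reach.map (ω' := ω) h₂ (fun e => ⟨upperMap n t e.src, e.dir.vflip⟩) (upperMap n t)
    (by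
      rintro ⟨⟨a, b⟩, d⟩
      cases d <;> simp [Edge.tgt, upperMap, Direction.vflip] <;> ring)
    (by
      rintro ⟨⟨a, b⟩, d⟩
      have key : Edge.tgt ⟨upperMap n t (a, b), d.vflip⟩ = upperMap n t (Edge.tgt ⟨(a, b), d⟩) := by
        cases d <;> simp [Edge.tgt, upperMap, Direction.vflip] <;> ring
      simp only [step, key, Site.turn_vflip])
    (upperMap_mapsTo t)
  have p₃ := p₂.rev
  have hneg : (1 : ZMod (2 * n)) - n - 1 = n := by
    have : ((2 * n : ℕ) : ZMod (2 * n)) = 0 := ZMod.natCast_self _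
    push_cast at this
    linear_combination -this
  simp only [Edge.rev, upperMap, lowerMap, Direction.vflip, Direction.opp, Edge.tgt,
    Int.cast_natCast, Int.cast_zero, hneg, sub_zero, sub_self] at p₁ p₃
  exact exists_winding_orbit p₁ p₃

lemma windingEvent_dependsOn [NeZero n] (t x' x : ℤ) :
    DependsOn (fun ω => ω ∈ windingEvent n t x' x) (strip n t (t + 100 * n)) :=
  (dependsOn_inter
    (dependsOn_reindex (dependsOn_reach _ _ _) (lowerMap n t) id (lowerMap_mapsTo t))
    (dependsOn_reindex (dependsOn_reach _ _ _) (upperMap n t) Site.flip (upperMap_mapsTo t))).mono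
      (Set.union_subset Set.inter_subset_left Set.inter_subset_left)

/-- The two halves are independent, and by reflection both contain the crossing with the same
probability as the box in the plane. -/
lemma real_windingEvent [NeZero n] {t : ℤ} (ht : Even t) (x' x : ℤ) :
    (law (ZMod (2 * n)) m p).real (windingEvent n t x' x)
      = (law ℤ m p).real (boxPath n x' x) ^ 2 := by
  have hE : DependsOn (fun ω => ω ∈ boxPath n x' x) (box n) := dependsOn_reach _ _ _
  have h1 := real_inter_of_dependsOn (μ := fun v : Vertex (ZMod (2 * n)) => siteLaw m p v)
    ((strip_finite t (t + 100 * n)).inter_of_left _)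
    ((strip_finite t (t + 100 * n)).inter_of_left _)
    (Disjoint.mono Set.inter_subset_right Set.inter_subset_right disjoint_compl_right)
    (dependsOn_reindex hE (lowerMap n t) id (lowerMap_mapsTo t))
    (dependsOn_reindex hE (upperMap n t) Site.flip (upperMap_mapsTo t))
  have hpar : ∀ a : ℤ, Even (a + t) ↔ Even a := fun a => by simp [Int.even_add, ht]
  have h2 := real_reindex (μ := fun v : Vertex (ZMod (2 * n)) => siteLaw m p v)
    (ν := fun v : Vertex ℤ => siteLaw m p v) (g := id) box_finite hE (lowerMap_injOn t) (by
      rintro ⟨a, b⟩ -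
      rw [Measure.map_id]
      refine siteLaw_congr ?_
      simp only [lowerMap, even_sub_zmod, even_intCast_zmod, hpar, Int.cast_id, Int.even_sub])
  have h3 := real_reindex (μ := fun v : Vertex (ZMod (2 * n)) => siteLaw m p v)
    (ν := fun v : Vertex ℤ => siteLaw m p v) (g := Site.flip) box_finite hE (upperMap_injOn t) (by
      rintro ⟨a, b⟩ -
      refine siteLaw_map_flip ?_
      have h4 : (1 : ZMod (2 * n)) - b = ((1 - b : ℤ) : ZMod (2 * n)) := by push_cast; rfl
      have h5 : Even (1 - b) ↔ ¬ Even b := by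
        rw [Int.even_sub]
        simp
      simp only [upperMap, h4, even_sub_zmod, even_intCast_zmod, hpar, h5, Int.cast_id,
        Int.even_sub]
      tauto)
  rw [h2, h3, ← sq] at h1
  exact h1

end Boxes

/-! ### The crossing light dies out -/

section Decay

variable {n : ℕ} {m : Model} {p : unitInterval}

lemma crossers_dependsOn {α : Type*} (T : ℤ) (P : Set (ZMod (2 * n)) → α) :
    DependsOn (fun ω => P (crossers ω T)) (strip n 0 T) := by
  intro ω ω' h
  simp only [crossers_congr h]

/-- The event that some light that crosses up to the column `t` does not cross up to the column
`T`. -/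
def lossEvent (n : ℕ) (t T : ℤ) : Set (Config (ZMod (2 * n))) :=
  {ω | crossers ω T ≠ crossers ω t}

lemma lossEvent_dependsOn {t T : ℤ} (h : t ≤ T) :
    DependsOn (fun ω => ω ∈ lossEvent n t T) (strip n 0 T) := by
  intro ω ω' hω
  have h1 := crossers_congr hω
  have h2 : crossers ω t = crossers ω' t := crossers_congr fun v hv => hω v ⟨hv.1, hv.2.trans h⟩
  simp only [lossEvent, Set.mem_ofPred_eq, h1, h2]

open Classical in
/-- On the winding event, changing the states of at most two vertices stops some of the crossing
light. Hence, as long as there is some, a loss of crossing light is at most polynomially less likely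
than the winding event, which is independent of the columns up to `t`. -/
lemma real_nonempty_mul_le [NeZero n] {t T : ℤ} (ht : 0 ≤ t) (hteven : Even t)
    (hT : T = t + 100 * n) (hp : 0 < p) (hp' : p < 1) (x' x : ℤ) :
    (law (ZMod (2 * n)) m p).real {ω | (crossers ω t).Nonempty}
        * (law ℤ m p).real (boxPath n x' x) ^ 2
      ≤ (1 + (600 * n ^ 2) ^ 2 / min (1 - (p : ℝ)) (p / 2) ^ 2)
        * (law (ZMod (2 * n)) m p).real (lossEvent n t T) := by
  set P := law (ZMod (2 * n)) m p with hP
  set δ := min (1 - (p : ℝ)) (p / 2) with hδ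
  set D := lossEvent n t T with hD
  have hδ0 : 0 < δ := by
    have h1 : (0 : ℝ) < p := hp
    have h2 : (p : ℝ) < 1 := hp'
    exact lt_min (by linarith) (by linarith)
  have htT : t ≤ T := by omega
  have hDdep : DependsOn (fun ω => ω ∈ D) (strip n 0 T) := lossEvent_dependsOn htT
  have hdisj : Disjoint (strip n 0 t) (strip n t T) := by
    rw [Set.disjoint_left]
    intro v h1 h2
    have := h1.2
    have := h2.1
    omega
  have hind : P.real ({ω | (crossers ω t).Nonempty} ∩ windingEvent n t x' x)
      = P.real {ω | (crossers ω t).Nonempty} * (law ℤ m p).real (boxPath n x' x) ^ 2 := by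
    rw [← real_windingEvent hteven]
    exact real_inter_of_dependsOn (μ := fun v => siteLaw m p v) (strip_finite 0 t)
      (strip_finite t T) hdisj (crossers_dependsOn t Set.Nonempty)
      (hT ▸ windingEvent_dependsOn t x' x)
  rw [← hind]
  -- The admissible modifications of two vertices of the new part of the cylinder.
  let V : Finset (Vertex (ZMod (2 * n))) := (strip_finite t T).toFinset
  let Q : Finset (Vertex (ZMod (2 * n)) × Site) := V ×ˢ {.empty, .nw, .ne}
  let F : Finset ((Vertex (ZMod (2 * n)) × Site) × (Vertex (ZMod (2 * n)) × Site)) :=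
    (Q ×ˢ Q).filter fun q => Allowed m q.1.1 q.1.2 ∧ Allowed m q.2.1 q.2.2
  let A : (Vertex (ZMod (2 * n)) × Site) × (Vertex (ZMod (2 * n)) × Site) →
      Set (Config (ZMod (2 * n))) := fun q =>
    {ω | Function.update (Function.update ω q.1.1 q.1.2) q.2.1 q.2.2 ∈ D}
  have hcover : ∀ᵐ ω ∂P, ω ∈ {ω | (crossers ω t).Nonempty} ∩ windingEvent n t x' x →
      ω ∈ D ∪ ⋃ q ∈ F, A q := by
    filter_upwards [ae_allowed (m := m) (p := p) n] with ω hω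
    rintro ⟨hne, hwind⟩
    by_cases hωD : ω ∈ D
    · exact .inl hωD
    · right
      have heq : crossers ω T = crossers ω t := not_not.1 hωD
      obtain ⟨g, N, hN, hg, hcol, hflow⟩ := exists_orbit_of_mem_windingEvent hwind
      rw [← hT] at hcol hflow
      obtain ⟨v₁, hv₁, v₂, hv₂, s₁, s₂, hs₁, hs₂, y, hy, hy'⟩ :=
        exists_surgery ht hω (by rw [heq]; exact hne) hN hg hcol hflow
      have hs : ∀ s : Site, s ∈ ({.empty, .nw, .ne} : Finset Site) := fun s => by
        cases s <;> simp
      simp only [Set.mem_iUnion, exists_prop]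
      refine ⟨((v₁, s₁), (v₂, s₂)), ?_, ?_⟩
      · simp only [F, Q, V, Finset.mem_filter, Finset.mem_product, Set.Finite.mem_toFinset]
        exact ⟨⟨⟨hv₁, hs _⟩, hv₂, hs _⟩, hs₁, hs₂⟩
      · intro hcontra
        have hsame : crossers ω t
            = crossers (Function.update (Function.update ω v₁ s₁) v₂ s₂) t := by
          refine crossers_congr fun v hv => ?_
          rw [Function.update_of_ne, Function.update_of_ne]
          · rintro rfl
            exact Set.disjoint_left.1 hdisj hv hv₁
          · rintro rfl
            exact Set.disjoint_left.1 hdisj hv hv₂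
        rw [hcontra, ← hsame, ← heq] at hy'
        exact hy' hy
  have hA : ∀ q ∈ F, P.real (A q) ≤ P.real D / δ ^ 2 := by
    rintro ⟨⟨v₁, s₁⟩, ⟨v₂, s₂⟩⟩ hq
    obtain ⟨-, hq1, hq2⟩ := Finset.mem_filter.1 hq
    have h1 := real_update_mul_le (μ := fun v => siteLaw m p v) (strip_finite 0 T) hDdep v₂ s₂
    have h2 := real_update_mul_le (μ := fun v => siteLaw m p v) (strip_finite 0 T)
      (dependsOn_update hDdep v₂ s₂) v₁ s₁
    have h3 := le_siteLaw_of_allowed (p := p) v₁ hq1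
    have h4 := le_siteLaw_of_allowed (p := p) v₂ hq2
    rw [le_div_iff₀ (by positivity)]
    calc P.real (A ((v₁, s₁), (v₂, s₂))) * δ ^ 2
        = P.real (A ((v₁, s₁), (v₂, s₂))) * δ * δ := by ring
      _ ≤ P.real (A ((v₁, s₁), (v₂, s₂))) * (siteLaw m p v₁).real {s₁} * δ := by gcongr
      _ ≤ P.real {ω | Function.update ω v₂ s₂ ∈ D} * δ := by gcongr; exact h2
      _ ≤ P.real {ω | Function.update ω v₂ s₂ ∈ D} * (siteLaw m p v₂).real {s₂} := by gcongr
      _ ≤ P.real D := h1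
  have hFcard : (F.card : ℝ) ≤ (600 * n ^ 2) ^ 2 := by
    have hV : V.card = 100 * n * (2 * n) := by
      have : V = Finset.Icc (t + 1) T ×ˢ Finset.univ := by
        ext v
        simp [V, strip]
      rw [this, Finset.card_product, Int.card_Icc, Finset.card_univ, ZMod.card]
      congr 1
      omega
    have h1 : F.card ≤ Q.card * Q.card := by
      rw [← Finset.card_product]
      exact Finset.card_filter_le _ _
    have h2 : Q.card = 600 * n ^ 2 := by
      have h3 : ({.empty, .nw, .ne} : Finset Site).card = 3 := rfl
      rw [Finset.card_product, hV, h3]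
      ring
    rw [h2] at h1
    calc (F.card : ℝ) ≤ ((600 * n ^ 2 * (600 * n ^ 2) : ℕ) : ℝ) := by exact_mod_cast h1
      _ = (600 * n ^ 2) ^ 2 := by push_cast; ring
  calc P.real ({ω | (crossers ω t).Nonempty} ∩ windingEvent n t x' x)
      ≤ P.real (D ∪ ⋃ q ∈ F, A q) := by
        rw [measureReal_def, measureReal_def]
        exact ENNReal.toReal_mono (measure_ne_top _ _) (measure_mono_ae hcover)
    _ ≤ P.real D + P.real (⋃ q ∈ F, A q) := measureReal_union_le _ _
    _ ≤ P.real D + ∑ q ∈ F, P.real (A q) := by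
        gcongr
        exact measureReal_biUnion_finset_le _ _
    _ ≤ P.real D + ∑ q ∈ F, P.real D / δ ^ 2 := by
        gcongr with q hq
        exact hA q hq
    _ = P.real D + F.card * (P.real D / δ ^ 2) := by rw [Finset.sum_const, nsmul_eq_mul]
    _ ≤ P.real D + (600 * n ^ 2) ^ 2 * (P.real D / δ ^ 2) := by gcongr
    _ = _ := by ring

/-- The expected number of heights at which light crosses up to the column `T`. -/
noncomputable def meanCrossers (n : ℕ) [NeZero n] (m : Model) (p : unitInterval) (T : ℤ) : ℝ :=
  ∑ y, (law (ZMod (2 * n)) m p).real {ω | y ∈ crossers ω T}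

lemma real_lossEvent_le [NeZero n] {t T : ℤ} (h : t ≤ T) :
    (law (ZMod (2 * n)) m p).real (lossEvent n t T)
      ≤ meanCrossers n m p t - meanCrossers n m p T := by
  set P := law (ZMod (2 * n)) m p with hP
  have hsub : lossEvent n t T
      ⊆ ⋃ y ∈ (Finset.univ : Finset (ZMod (2 * n))),
        ({ω | y ∈ crossers ω t} \ {ω | y ∈ crossers ω T}) := by
    intro ω hω
    obtain ⟨y, hy, hy'⟩ := Set.exists_of_ssubset ((crossers_anti ω h).ssubset_of_ne hω)
    simp only [Set.mem_iUnion, exists_prop]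
    exact ⟨y, Finset.mem_univ _, hy, hy'⟩
  calc P.real (lossEvent n t T)
      ≤ ∑ y, P.real ({ω | y ∈ crossers ω t} \ {ω | y ∈ crossers ω T}) :=
        (measureReal_mono hsub (measure_ne_top _ _)).trans (measureReal_biUnion_finset_le _ _)
    _ = ∑ y, (P.real {ω | y ∈ crossers ω t} - P.real {ω | y ∈ crossers ω T}) := by
        refine Finset.sum_congr rfl fun y _ => ?_
        refine measureReal_sdiff (fun ω hω => crossers_anti ω h hω) ?_
        exact measurableSet_of_dependsOn (strip_finite 0 T) (crossers_dependsOn T fun X => y ∈ X)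
    _ = _ := by rw [Finset.sum_sub_distrib, meanCrossers, meanCrossers]

/-- After `J` parts of length `100 n`, the probability that some light still crosses is at most a
constant times `n / J`, divided by the probability of a loss in a single part. -/
lemma mul_real_nonempty_le [NeZero n] (hp : 0 < p) (hp' : p < 1) (x' x : ℤ) (J : ℕ) :
    J * ((law (ZMod (2 * n)) m p).real {ω | (crossers ω (100 * n * J : ℤ)).Nonempty}
        * (law ℤ m p).real (boxPath n x' x) ^ 2)
      ≤ (1 + (600 * n ^ 2) ^ 2 / min (1 - (p : ℝ)) (p / 2) ^ 2) * (2 * n) := by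
  set P := law (ZMod (2 * n)) m p with hP
  set C := 1 + (600 * (n : ℝ) ^ 2) ^ 2 / min (1 - (p : ℝ)) (p / 2) ^ 2 with hC
  have hC0 : 0 ≤ C := by positivity
  have hstep : ∀ j ∈ Finset.range J,
      P.real {ω | (crossers ω (100 * n * J : ℤ)).Nonempty} * (law ℤ m p).real (boxPath n x' x) ^ 2
        ≤ C * (meanCrossers n m p (100 * n * (j : ℕ) : ℤ)
          - meanCrossers n m p (100 * n * (j + 1 : ℕ) : ℤ)) := by
    intro j hj
    have hjJ : (j : ℤ) ≤ J := by exact_mod_cast (Finset.mem_range.1 hj).le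
    have hle : (100 * n * j : ℤ) ≤ 100 * n * J := by gcongr
    have hle' : (100 * n * j : ℤ) ≤ 100 * n * (j + 1 : ℕ) := by push_cast; gcongr; omega
    calc _ ≤ P.real {ω | (crossers ω (100 * n * j : ℤ)).Nonempty}
          * (law ℤ m p).real (boxPath n x' x) ^ 2 := by
          gcongr ?_ * _
          exact measureReal_mono (fun ω hω => hω.mono (crossers_anti ω hle)) (measure_ne_top _ _)
      _ ≤ C * P.real (lossEvent n (100 * n * j) (100 * n * (j + 1 : ℕ))) :=
          real_nonempty_mul_le (by positivity)
            (by rw [mul_assoc]; exact Even.mul_right (by decide) _) (by push_cast; ring) hp hp' _ _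
      _ ≤ _ := by
          gcongr
          exact real_lossEvent_le hle'
  have hsum := Finset.sum_le_sum hstep
  rw [Finset.sum_const, Finset.card_range, nsmul_eq_mul, ← Finset.mul_sum,
    Finset.sum_range_sub' fun j : ℕ => meanCrossers n m p (100 * n * (j : ℕ) : ℤ)] at hsum
  refine hsum.trans ?_
  gcongr
  have h0 : meanCrossers n m p (100 * n * (0 : ℕ) : ℤ) = 2 * n := by
    simp only [meanCrossers, Nat.cast_zero, mul_zero, crossers_zero, Set.mem_univ, Set.ofPred_true,
      probReal_univ, Finset.sum_const, Finset.card_univ, ZMod.card, nsmul_eq_mul, mul_one]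
    push_cast
    ring
  have h1 : 0 ≤ meanCrossers n m p (100 * n * J : ℤ) :=
    Finset.sum_nonneg fun y _ => measureReal_nonneg
  linarith

end Decay

/-! ### Rotation, and the confinement of trajectories -/

section Confinement

variable {n : ℕ} {m : Model} {p : unitInterval} {ω : Config (ZMod (2 * n))}
  {e : Edge (ZMod (2 * n))} {T : ℤ}

/-- A path from a column `≤ 0` to a column beyond `T` contains a crossing, which begins after its
last visit to the columns `≤ 0`. -/
lemma crossers_nonempty_of_iterate (k : ℕ) (he : e.src.1 ≤ 0)
    (hk : T < ((step ω)^[k] e).src.1) (hT : 0 ≤ T) : (crossers ω T).Nonempty := by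
  induction k using Nat.strong_induction_on generalizing e with
  | _ k ih =>
    by_cases h : ∃ i, 0 < i ∧ i ≤ k ∧ ((step ω)^[i] e).src.1 ≤ 0
    · obtain ⟨i, hi, hik, h⟩ := h
      refine ih (k - i) (by omega) h ?_
      rwa [← Function.iterate_add_apply, Nat.sub_add_cancel hik]
    · push Not at h
      obtain ⟨k, rfl⟩ : ∃ k', k = k' + 1 := by
        refine Nat.exists_eq_succ_of_ne_zero ?_
        rintro rfl
        simp only [Function.iterate_zero, id] at hk
        omega
      have htgt : ∀ i ≤ k, 0 < ((step ω)^[i] e).tgt.1 := fun i hi => by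
        have := h (i + 1) (by omega) (by omega)
        rwa [Function.iterate_succ_apply', step_src] at this
      have hent : ∃ y, e = entry y := by
        have h0 := htgt 0 (by omega)
        obtain ⟨⟨a, b⟩, d⟩ := e
        simp only [Function.iterate_zero, id] at h0
        have ha : a ≤ 0 := he
        cases d
        · simp only [tgt_east] at h0
          obtain rfl : a = 0 := by omega
          exact ⟨b, rfl⟩
        · simp only [tgt_north] at h0; omega
        · simp only [tgt_west] at h0; omega
        · simp only [tgt_south] at h0; omega
      obtain ⟨y, rfl⟩ := hent
      refine ⟨y, _, reach_iff_iterate.2 ⟨k, rfl, fun i hi => htgt i hi.le⟩, ?_⟩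
      rwa [Function.iterate_succ_apply', step_src] at hk

/-- A trajectory that visits both the column `0` and a column beyond `T`, in either order, contains
a crossing, up to time reversal. -/
lemma crossers_nonempty_of_visits {i j : ℕ} (hi : ((step ω)^[i] e).src.1 = 0)
    (hj : T < ((step ω)^[j] e).src.1) (hT : 0 ≤ T) : (crossers ω T).Nonempty := by
  rcases le_or_gt i j with h | h
  · refine crossers_nonempty_of_iterate (e := (step ω)^[i] e) (j - i) hi.le ?_ hT
    rwa [← Function.iterate_add_apply, Nat.sub_add_cancel h]
  · obtain ⟨k, rfl⟩ : ∃ k, i = k + 1 := Nat.exists_eq_succ_of_ne_zero (by omega)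
    refine crossers_nonempty_of_iterate (e := ((step ω)^[k] e).rev) (k - j + 1) ?_ ?_ hT
    · rw [Edge.rev_src, ← step_src ω, ← Function.iterate_succ_apply' (step ω), hi]
    · rw [Function.iterate_succ_apply', step_src, iterate_step_rev_of_le ω e (by omega),
        Edge.rev_tgt, show k - (k - j) = j by omega]
      exact hj

/-- The image of an edge under the rotation `v ↦ -v`. -/
def Edge.rot (e : Edge (ZMod (2 * n))) : Edge (ZMod (2 * n)) := ⟨-e.src, e.dir.opp⟩

lemma iterate_step_rot (ω : Config (ZMod (2 * n))) (e : Edge (ZMod (2 * n))) (i : ℕ) :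
    (step fun v => ω (-v))^[i] e.rot = ((step ω)^[i] e).rot := by
  refine (Function.Semiconj.iterate_right (f := Edge.rot) (fun e => ?_) i e).symm
  have h1 : e.rot.tgt = -e.tgt := by
    obtain ⟨⟨a, b⟩, d⟩ := e
    cases d <;> simp [Edge.tgt, Edge.rot, Direction.opp] <;> ring
  have h2 : ∀ (s : Site) (d : Direction), s.turn d.opp = (s.turn d).opp := by
    intro s d
    cases s <;> cases d <;> rfl
  ext1
  · rw [step_src, h1]
    rfl
  · have h3 : (step (fun v => ω (-v)) e.rot).dir = (ω (-e.rot.tgt)).turn e.dir.opp := rfl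
    rw [h3, h1, neg_neg, h2]
    rfl

/-- The rotation `v ↦ -v` preserves the law of the configuration. -/
lemma real_crossers_rot [NeZero n] (T : ℤ) :
    (law (ZMod (2 * n)) m p).real {ω | (crossers (fun v => ω (-v)) T).Nonempty}
      = (law (ZMod (2 * n)) m p).real {ω | (crossers ω T).Nonempty} := by
  refine real_reindex (μ := fun v : Vertex (ZMod (2 * n)) => siteLaw m p v)
    (ν := fun v : Vertex (ZMod (2 * n)) => siteLaw m p v) (g := id) (ψ := fun v => -v)
    (E := {ω | (crossers ω T).Nonempty}) (strip_finite 0 T)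
    (crossers_dependsOn T Set.Nonempty) neg_injective.injOn ?_
  intro v _
  rw [Measure.map_id]
  refine siteLaw_congr ?_
  have : (((-v).1 : ℤ) : ZMod (2 * n)) - (-v).2 = -(((v.1 : ℤ) : ZMod (2 * n)) - v.2) := by
    simp only [Prod.fst_neg, Prod.snd_neg]
    push_cast
    ring
  rw [this, even_neg]

lemma mem_localized {C : ℝ} (hT : 0 ≤ T) (hTC : T ≤ ⌊C * (n : ℝ) ^ 10⌋)
    (h : ¬ (crossers ω T).Nonempty) (h' : ¬ (crossers (fun v => ω (-v)) T).Nonempty) :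
    ω ∈ localized n C := by
  rintro L ⟨v, hv, hv0⟩ w hw
  obtain ⟨i, hi⟩ := L.exists_iterate_src hv
  obtain ⟨j, hj⟩ := L.exists_iterate_src hw
  constructor
  · by_contra hlt
    refine h' (crossers_nonempty_of_visits (e := L.initialEdge.rot) (i := i) (j := j) ?_ ?_ hT)
    · rw [iterate_step_rot]
      simp [Edge.rot, hi, hv0]
    · rw [iterate_step_rot]
      simp only [Edge.rot, hj, Prod.fst_neg]
      omega
  · by_contra hlt
    refine h (crossers_nonempty_of_visits (e := L.initialEdge) (i := i) (j := j) ?_ ?_ hT)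
    · rw [hi, hv0]
    · rw [hj]
      omega

end Confinement

end MirrorModel

theorem mainTheorem2 (m : MirrorModel.Model) (c₀ : ℝ) (hc₀ : 0 < c₀) (hc₀' : c₀ < 1)
    (p : unitInterval) (hp : 0 < p) (hp' : p < 1) :
    ∃ C₁ : ℝ, 0 < C₁ ∧ ∀ n : ℕ, C₁ < (n : ℝ) →
      c₀ ≤ (MirrorModel.law ℤ m p).real (MirrorModel.boxCrossing (100 * n) n) →
      (1 / 2 : ℝ) ≤
        (MirrorModel.law (ZMod (2 * n)) m p).real (MirrorModel.localized n C₁) := by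
  open MirrorModel MeasureTheory in
  have hp0 : (0 : ℝ) < p := hp
  have hp1 : (p : ℝ) < 1 := hp'
  set δ := min (1 - (p : ℝ)) (p / 2) with hδ
  have hδ0 : 0 < δ := lt_min (by linarith) (by linarith)
  have hδ1 : δ ≤ 1 := (min_le_left _ _).trans (by linarith)
  -- With `J` parts of length `100 n`, `J` being about `B n ^ 9`, the bound below becomes `1 / 4`.
  set B : ℝ := 8 * 100 ^ 4 * (1 + 600 ^ 2) / (δ ^ 2 * c₀ ^ 2) with hB
  have hB0 : 0 < B := by positivity
  refine ⟨100 * (B + 1), by positivity, fun n hn hcross => ?_⟩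
  have hn1 : (1 : ℝ) ≤ n := by linarith
  have hnpos : 0 < n := by exact_mod_cast (zero_lt_one.trans_le hn1)
  have : NeZero n := ⟨hnpos.ne'⟩
  obtain ⟨x', x, hx⟩ := exists_boxPath hcross
  set J := ⌈B * (n : ℝ) ^ 9⌉₊ with hJ
  have hJle : B * (n : ℝ) ^ 9 ≤ J := Nat.le_ceil _
  have hJlt : (J : ℝ) < B * (n : ℝ) ^ 9 + 1 := Nat.ceil_lt_add_one (by positivity)
  have hmain := mul_real_nonempty_le (n := n) (m := m) hp hp' x' x J
  set P := law (ZMod (2 * n)) m p with hP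
  set a := P.real {ω | (crossers ω (100 * n * J : ℤ)).Nonempty} with ha
  have ha0 : 0 ≤ a := measureReal_nonneg
  have ha4 : a ≤ 1 / 4 := by
    by_contra! hcon
    have h1 : B * (n : ℝ) ^ 9 * (1 / 4 * (c₀ / (100 * n) ^ 2) ^ 2)
        < J * (a * (law ℤ m p).real (boxPath n x' x) ^ 2) := by
      have h2 : (0 : ℝ) < (c₀ / (100 * n) ^ 2) ^ 2 := by positivity
      have h3 : (0 : ℝ) < B * (n : ℝ) ^ 9 := by positivity
      calc B * (n : ℝ) ^ 9 * (1 / 4 * (c₀ / (100 * n) ^ 2) ^ 2)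
          < B * (n : ℝ) ^ 9 * (a * (c₀ / (100 * n) ^ 2) ^ 2) := by gcongr
        _ ≤ J * (a * (law ℤ m p).real (boxPath n x' x) ^ 2) := by gcongr
    have h4 : B * (n : ℝ) ^ 9 * (1 / 4 * (c₀ / (100 * n) ^ 2) ^ 2)
        = (1 + 600 ^ 2) * n ^ 4 / δ ^ 2 * (2 * n) := by
      rw [hB]
      field_simp
      ring
    have h5 : 1 + (600 * (n : ℝ) ^ 2) ^ 2 / δ ^ 2 ≤ (1 + 600 ^ 2) * n ^ 4 / δ ^ 2 := by
      have h6 : 1 ≤ (n : ℝ) ^ 4 / δ ^ 2 := by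
        rw [one_le_div (by positivity)]
        exact (pow_le_one₀ hδ0.le hδ1).trans (one_le_pow₀ hn1)
      calc _ ≤ (n : ℝ) ^ 4 / δ ^ 2 + (600 * (n : ℝ) ^ 2) ^ 2 / δ ^ 2 := by gcongr
        _ = _ := by ring
    have h7 : (1 + (600 * (n : ℝ) ^ 2) ^ 2 / δ ^ 2) * (2 * n)
        ≤ (1 + 600 ^ 2) * n ^ 4 / δ ^ 2 * (2 * n) := by gcongr
    linarith
  have hTC : (100 * n * J : ℤ) ≤ ⌊100 * (B + 1) * (n : ℝ) ^ 10⌋ := by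
    rw [Int.le_floor]
    push_cast
    calc (100 : ℝ) * n * J ≤ 100 * n * (B * n ^ 9 + n ^ 9) := by
          gcongr
          exact hJlt.le.trans (by gcongr; exact one_le_pow₀ hn1)
      _ = 100 * (B + 1) * (n : ℝ) ^ 10 := by ring
  set T : ℤ := 100 * n * J with hT
  have hT0 : 0 ≤ T := by positivity
  have hcover : (Set.univ : Set (Config (ZMod (2 * n)))) ⊆ localized n (100 * (B + 1)) ∪
      ({ω | (crossers ω T).Nonempty} ∪ {ω | (crossers (fun v => ω (-v)) T).Nonempty}) := by
    intro ω _
    by_cases h1 : (crossers ω T).Nonempty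
    · exact .inr (.inl h1)
    · by_cases h2 : (crossers (fun v => ω (-v)) T).Nonempty
      · exact .inr (.inr h2)
      · exact .inl (mem_localized hT0 hTC h1 h2)
  have h1 : (1 : ℝ) ≤ P.real (localized n (100 * (B + 1))) + (a + a) := by
    calc (1 : ℝ) = P.real Set.univ := probReal_univ.symm
      _ ≤ _ := measureReal_mono hcover (measure_ne_top _ _)
      _ ≤ _ := measureReal_union_le _ _
      _ ≤ P.real (localized n (100 * (B + 1))) + (a
          + P.real {ω | (crossers (fun v => ω (-v)) T).Nonempty}) := by
          gcongr
          exact measureReal_union_le _ _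
      _ = _ := by rw [hP, real_crossers_rot]
  linarith
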